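/- Let $\varphi:\mathbb R\to[0,1]$ be continuous with $\operatorname{supp}\varphi\subset(-1/2,1/2)$ and with $\varphi(x)=1$ if and only if $x=0$, and let $0<q<1$. Let $\Omega_0=\{-1,1\}^{\mathbb Z}$ carry the product measure $\nu_q$ of the measures giving mass $q$ to $-1$ and $1-q$ to $1$. For $\mathbf x\in\Omega_0$ put $\Lambda_{\mathbf x}(t)=\sum_{m\in\mathbb Z}\mathbf x_m\varphi(t-m)$, and let $$\Omega=\{\Lambda_{\mathbf x}(\cdot+\delta):\ \mathbf x\in\Omega_0,\ \delta\in\mathbb R\}.$$ The map $(\mathbf x,\theta)\mapsto\Lambda_{\mathbf x}(\cdot+\theta)$ is a bijection of $\Omega_0\times[0,1)$ onto $\Omega$; let $\mu_q$ be the probability measure on $\Omega$ obtained by transporting along it the product of $\nu_q$ and the Lebesgue measure on $[0,1)$ (with the transported $\sigma$-algebra). Let $T(z)\omega=\omega(\cdot+z)$ for $z\in\mathbb R$, $\omega\in\Omega$, and $f(\omega)=\omega(0)$. A bounded function $g:\mathbb R\to\mathbb R$ has mean value $M(g)\in\mathbb R$ if $\int_{\mathbb R} g(x/\varepsilon)h(x)\,dx\to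 M(g)\int_{\mathbb R} h(x)\,dx$ as $\varepsilon\to0^+$ for every compactly supported $h\in L^\infty(\mathbb R)$. An algebra with mean value is a linear subspace $\mathcal A$ of the space of real-valued bounded uniformly continuous functions on $\mathbb R$ that is closed in the supremum norm, closed under products and under all translations $g\mapsto g(\cdot+k)$, $k\in\mathbb R$, and all of whose elements have a mean value. Let $[g]_2=M(g^2)^{1/2}$, and let $\mathcal B^2$ be the completion of $\mathcal A$ modulo $[\cdot]_2$-null functions. The algebra $\mathcal A$ is ergodic if every $g\in\mathcal B^2$ with $g(\cdot+k)=g$ in $\mathcal B^2$ for all $k\in\mathbb R$ is equivalent to a constant, i.e. whenever $(u_n)\subset\mathcal A$ is a $[\cdot]_2$-Cauchy sequence with $\lim_n[u_n(\cdot+k)-u_n]_2=0$ for all $k\in\mathbb R$, there is $c\in\mathbb R$ with $\lim_n[u_n-c]_2=0$. An ergodic function is a function that belongs to some ergodic algebra with mean value. Claim: $f(T(z)\omega)=\omega(z)$ for all $\omega\in\Omega$ and $z\in\mathbb R$, and for $\mu_q$-almost every $\omega\in\Omega$ the function $\omega(\cdot)=f(T(\cdot)\omega)$ is an ergodic function.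 -/

import Mathlib

open MeasureTheory Filter Topology
open scoped BoundedContinuousFunction

noncomputable section

namespace ErgodicFunctions

/-! ### Mean values and ergodic algebras on the real line -/

/-- `f` has mean value `m`: the functions `f (· / ε)` converge to the constant `m` as `ε → 0⁺`,
in the duality with essentially bounded compactly supported functions. -/
def HasMeanValue (f : ℝ → ℝ) (m : ℝ) : Prop :=
  ∀ g : ℝ → ℝ, MemLp g ⊤ volume → HasCompactSupport g →
    Tendsto (fun ε : ℝ => ∫ x, f (x / ε) * g x) (𝓝[>] 0) (𝓝 (m * ∫ x, g x))

/-- Mean values are unique. -/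
theorem HasMeanValue.unique {f : ℝ → ℝ} {m m' : ℝ} (h : HasMeanValue f m)
    (h' : HasMeanValue f m') : m = m' := by
  have hg : MemLp (Set.indicator (Set.Icc (0 : ℝ) 1) (fun _ => (1 : ℝ))) ⊤ volume :=
    memLp_indicator_const ⊤ measurableSet_Icc 1 (Or.inr (by simp))
  have hc : HasCompactSupport (Set.indicator (Set.Icc (0 : ℝ) 1) (fun _ => (1 : ℝ))) :=
    HasCompactSupport.intro (K := Set.Icc (0 : ℝ) 1) isCompact_Icc
      (fun x hx => Set.indicator_of_notMem hx _)
  have hi : ∫ x, Set.indicator (Set.Icc (0 : ℝ) 1) (fun _ => (1 : ℝ)) x = 1 := by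
    rw [integral_indicator measurableSet_Icc]; simp
  have key := tendsto_nhds_unique (h _ hg hc) (h' _ hg hc)
  rwa [hi, mul_one, mul_one] at key

open Classical in
/-- The mean value `M(f)` (and `0` if `f` has no mean value). -/
def meanValue (f : ℝ → ℝ) : ℝ :=
  if h : ∃ m, HasMeanValue f m then h.choose else 0

theorem HasMeanValue.meanValue_eq {f : ℝ → ℝ} {m : ℝ} (h : HasMeanValue f m) :
    meanValue f = m := by
  have h' : ∃ m, HasMeanValue f m := ⟨m, h⟩
  rw [meanValue, dif_pos h']
  exact h'.choose_spec.unique h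

/-- The translate `f (· + k)` of a bounded continuous function. -/
def translate (k : ℝ) (f : ℝ →ᵇ ℝ) : ℝ →ᵇ ℝ :=
  f.compContinuous ⟨fun x => x + k, continuous_add_const k⟩

/-- An algebra with mean value: a subalgebra (not assumed to contain the constants) of the bounded
uniformly continuous functions on `ℝ`, closed for the supremum norm, invariant under translations,
all of whose elements have a mean value. -/
structure IsAlgebraWithMeanValue (A : NonUnitalSubalgebra ℝ (ℝ →ᵇ ℝ)) : Prop where
  uniformContinuous : ∀ f ∈ A, UniformContinuous f
  isClosed : IsClosed (A : Set (ℝ →ᵇ ℝ))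
  translate_mem : ∀ f ∈ A, ∀ k : ℝ, translate k f ∈ A
  exists_meanValue : ∀ f ∈ A, ∃ m, HasMeanValue f m

/-- The Besicovitch seminorm `[f]₂ = M(f²)^{1/2}`. -/
def besicovitchSeminorm (f : ℝ →ᵇ ℝ) : ℝ :=
  Real.sqrt (meanValue (fun x => f x ^ 2))

/-- `u` is a sequence of elements of `A` that is Cauchy for `[·]₂`. The Besicovitch space `ℬ²` of
`A` (the completion of `A` modulo `[·]₂`-null functions) is the set of such sequences modulo
`BesicovitchEq`. -/
def BesicovitchCauchy (A : NonUnitalSubalgebra ℝ (ℝ →ᵇ ℝ)) (u : ℕ → ℝ →ᵇ ℝ) : Prop :=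
  (∀ n, u n ∈ A) ∧
    ∀ ε > 0, ∃ N : ℕ, ∀ m ≥ N, ∀ n ≥ N, besicovitchSeminorm (u m - u n) < ε

/-- Two sequences represent the same element of `ℬ²`. -/
def BesicovitchEq (u v : ℕ → ℝ →ᵇ ℝ) : Prop :=
  Tendsto (fun n => besicovitchSeminorm (u n - v n)) atTop (𝓝 0)

/-- An ergodic algebra: an algebra with mean value such that every element of `ℬ²` that is
invariant in `ℬ²` under all translations is equivalent in `ℬ²` to a constant. -/
def IsErgodicAlgebra (A : NonUnitalSubalgebra ℝ (ℝ →ᵇ ℝ)) : Prop :=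
  IsAlgebraWithMeanValue A ∧
    ∀ u : ℕ → ℝ →ᵇ ℝ, BesicovitchCauchy A u →
      (∀ k : ℝ, BesicovitchEq (fun n => translate k (u n)) u) →
      ∃ c : ℝ, BesicovitchEq u (fun _ => BoundedContinuousFunction.const ℝ c)

/-- An ergodic function: an element of some ergodic algebra. -/
def IsErgodicFunction (w : ℝ → ℝ) : Prop :=
  ∃ A : NonUnitalSubalgebra ℝ (ℝ →ᵇ ℝ), IsErgodicAlgebra A ∧ ∃ f ∈ A, ∀ x, f x = w x

/-! ### The probability space of functions and its shift -/

/-- The assumptions on the profile `φ`. -/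
structure IsProfile (φ : ℝ → ℝ) : Prop where
  continuous : Continuous φ
  tsupport_subset : tsupport φ ⊆ Set.Ioo (-(1 / 2)) (1 / 2)
  nonneg : ∀ x, 0 ≤ φ x
  le_one : ∀ x, φ x ≤ 1
  eq_one_iff : ∀ x, φ x = 1 ↔ x = 0

/-- The two-point set `{-1, 1}`. -/
abbrev TwoPoint : Type := ({-1, 1} : Set ℝ)

/-- The sequence space `Ω₀ = {-1, 1}^ℤ`. -/
abbrev SeqSpace : Type := ℤ → TwoPoint

/-- The measure on `{-1, 1}` giving mass `q` to `-1` and mass `1 - q` to `1`. -/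
def twoPointMeasure (q : ℝ) : Measure TwoPoint :=
  ENNReal.ofReal q • Measure.dirac ⟨-1, by simp⟩ +
    ENNReal.ofReal (1 - q) • Measure.dirac ⟨1, by simp⟩

theorem isProbabilityMeasure_twoPointMeasure {q : ℝ} (h0 : 0 < q) (h1 : q < 1) :
    IsProbabilityMeasure (twoPointMeasure q) := by
  constructor
  simp only [twoPointMeasure, Measure.add_apply, Measure.smul_apply, measure_univ, smul_eq_mul,
    mul_one]
  rw [← ENNReal.ofReal_add h0.le (by linarith)]
  simp

/-- The product measure `ν_q` on `Ω₀`. -/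
def seqMeasure (q : ℝ) : Measure SeqSpace :=
  Measure.infinitePi (fun _ : ℤ => twoPointMeasure q)

/-- `Λ_x(t) = ∑_{m ∈ ℤ} x_m φ(t - m)`. -/
def Lam (φ : ℝ → ℝ) (x : SeqSpace) (t : ℝ) : ℝ :=
  ∑' m : ℤ, (x m : ℝ) * φ (t - m)

/-- The set `Ω` of all functions `Λ_x(· + δ)` with `x ∈ Ω₀` and `δ ∈ ℝ`. -/
def Omega (φ : ℝ → ℝ) : Set (ℝ → ℝ) :=
  {w | ∃ (x : SeqSpace) (δ : ℝ), w = fun t => Lam φ x (t + δ)}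

/-- The map `Ω₀ × [0, 1) → Ω`, `(x, θ) ↦ Λ_x(· + θ)`. It is a bijection, the inverse of
`H : Λ_x(· + δ) ↦ (τ_{⌊δ⌋} x, δ - ⌊δ⌋)`. -/
def ofCoord (φ : ℝ → ℝ) (p : SeqSpace × Set.Ico (0 : ℝ) 1) : Omega φ :=
  ⟨fun t => Lam φ p.1 (t + p.2), p.1, p.2, rfl⟩

theorem IsProfile.eq_zero {φ : ℝ → ℝ} (hφ : IsProfile φ) {s : ℝ} (hs : 1 / 2 ≤ |s|) :
    φ s = 0 := by
  by_contra h
  have := hφ.tsupport_subset (subset_tsupport φ h)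
  have h2 : |s| < 1 / 2 := abs_lt.2 ⟨this.1, this.2⟩
  linarith

theorem IsProfile.lam_eq {φ : ℝ → ℝ} (hφ : IsProfile φ) (x : SeqSpace) (s : ℝ) :
    Lam φ x s = (x (round s) : ℝ) * φ (s - round s) := by
  refine tsum_eq_single (round s) fun m hm => ?_
  rw [hφ.eq_zero, mul_zero]
  have h1 := abs_sub_round s
  have h2 : (1 : ℝ) ≤ |(round s : ℝ) - m| := by
    have : (1 : ℤ) ≤ |round s - m| := Int.one_le_abs (sub_ne_zero.2 (Ne.symm hm))
    exact_mod_cast this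
  have h3 : |(round s : ℝ) - m| ≤ |s - m| + |s - round s| := by
    have := abs_sub (s - m) (s - round s)
    rwa [show (s - m) - (s - round s) = (round s : ℝ) - m by ring] at this
  linarith

theorem IsProfile.lam_int {φ : ℝ → ℝ} (hφ : IsProfile φ) (x : SeqSpace) (m : ℤ) :
    Lam φ x m = x m := by
  rw [hφ.lam_eq, round_intCast, sub_self, (hφ.eq_one_iff 0).2 rfl, mul_one]

theorem abs_twoPoint (a : TwoPoint) : |(a : ℝ)| = 1 := by
  rcases a.2 with h | h <;> simp_all

theorem ofCoord_surjective (φ : ℝ → ℝ) : Function.Surjective (ofCoord φ) := by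
  rintro ⟨w, x, δ, rfl⟩
  refine ⟨(fun j => x (j + ⌊δ⌋), ⟨Int.fract δ, Int.fract_nonneg δ, Int.fract_lt_one δ⟩), ?_⟩
  apply Subtype.ext
  funext t
  change Lam φ _ (t + Int.fract δ) = Lam φ x (t + δ)
  unfold Lam
  rw [← (Equiv.addRight ⌊δ⌋).tsum_eq (fun m : ℤ => (x m : ℝ) * φ (t + δ - m))]
  refine tsum_congr fun m => ?_
  simp only [Equiv.coe_addRight]
  congr 2
  push_cast
  rw [Int.fract]
  ring

theorem IsProfile.ofCoord_injective {φ : ℝ → ℝ} (hφ : IsProfile φ) :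
    Function.Injective (ofCoord φ) := by
  rintro ⟨x, θ, hθ⟩ ⟨y, η, hη⟩ h
  have key : ∀ t, Lam φ x (t + θ) = Lam φ y (t + η) := fun t => congrFun (congrArg Subtype.val h) t
  have h0 : |Lam φ y (-θ + η)| = 1 := by
    have h1 := key (-θ)
    rw [neg_add_cancel, ← Int.cast_zero, hφ.lam_int] at h1
    rw [← h1, abs_twoPoint]
  rw [hφ.lam_eq, abs_mul, abs_twoPoint, one_mul, abs_of_nonneg (hφ.nonneg _), hφ.eq_one_iff] at h0
  have hr : round (-θ + η) = 0 := by
    have a1 : ((-1 : ℤ) : ℝ) < (round (-θ + η) : ℤ) := by push_cast; linarith [hθ.2, hη.1]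
    have a2 : ((round (-θ + η) : ℤ) : ℝ) < (1 : ℤ) := by push_cast; linarith [hθ.1, hη.2]
    have b1 := Int.cast_lt.1 a1
    have b2 := Int.cast_lt.1 a2
    omega
  rw [hr] at h0
  have hθη : θ = η := by push_cast at h0; linarith
  subst hθη
  have hxy : x = y := by
    funext m
    have := key (m - θ)
    rw [sub_add_cancel, hφ.lam_int, hφ.lam_int] at this
    exact Subtype.ext this
  rw [hxy]

theorem IsProfile.ofCoord_bijective {φ : ℝ → ℝ} (hφ : IsProfile φ) :
    Function.Bijective (ofCoord φ) :=
  ⟨hφ.ofCoord_injective, ofCoord_surjective φ⟩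

/-- The σ-algebra that `Ω` inherits from `Ω₀ × [0, 1)`. -/
instance instMeasurableSpaceOmega (φ : ℝ → ℝ) : MeasurableSpace (Omega φ) :=
  MeasurableSpace.map (ofCoord φ) inferInstance

/-- The Lebesgue measure on `[0, 1)`. -/
def lebesgueIco : Measure (Set.Ico (0 : ℝ) 1) :=
  Measure.comap Subtype.val volume

/-- The measure `μ_q` that `Ω` inherits from the product of `ν_q` and the Lebesgue measure on
`[0, 1)`. -/
def omegaMeasure (φ : ℝ → ℝ) (q : ℝ) : Measure (Omega φ) :=
  Measure.map (ofCoord φ) ((seqMeasure q).prod lebesgueIco)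

theorem isProbabilityMeasure_omegaMeasure (φ : ℝ → ℝ) {q : ℝ} (h0 : 0 < q) (h1 : q < 1) :
    IsProbabilityMeasure (omegaMeasure φ q) := by
  have := isProbabilityMeasure_twoPointMeasure h0 h1
  have h2 : IsProbabilityMeasure (seqMeasure q) := by unfold seqMeasure; infer_instance
  have h3 : IsProbabilityMeasure lebesgueIco := by
    constructor
    rw [lebesgueIco, (MeasurableEmbedding.subtype_coe measurableSet_Ico).comap_apply,
      Set.image_univ, Subtype.range_coe, Real.volume_Ico]
    simp
  have hm : Measurable (ofCoord φ) := fun s hs => hs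
  exact Measure.isProbabilityMeasure_map hm.aemeasurable

/-- The shift operator `T(z) ω = ω(· + z)` on `Ω`. -/
def shift (φ : ℝ → ℝ) (z : ℝ) (w : Omega φ) : Omega φ :=
  ⟨fun t => w.1 (t + z), by
    obtain ⟨x, δ, h⟩ := w.2
    refine ⟨x, z + δ, ?_⟩
    funext t
    rw [h]
    simp only [add_assoc]⟩

/-- The function `f(ω) = ω(0)` on `Ω`. -/
def evalZero (φ : ℝ → ℝ) (w : Omega φ) : ℝ :=
  w.1 0

end ErgodicFunctions

end

/-! Almost every `x` is generic: every finite word occurs in `x`, along each half of `ℤ`, with its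
probability as frequency (`ae_isGeneric`). Fix such an `x`. The functions whose values near an
integer `n` are determined, up to small errors, by a word of `x` around `n` form a closed
translation-invariant algebra, `localAlgebra x`. It contains the constants and every `Λ_x(· + θ)`,
so it suffices to show that it has mean values and is ergodic.

Mean values: the integrals of such a function over the cells `[n, n + 1]` are uniform limits of
functions of finite windows of `x`, so genericity makes their averages converge in both directions
(`IsGeneric.exists_hasSeqMean`). Boundedness and density then pass from intervals to all test
functions (`hasMeanValue_of_hasSeqMean`).

Ergodicity rests on a spectral-gap-like inequality: if `M((g(· + k) - g)²) ≤ δ` for all `k`, then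
`M((g - M(g))²) ≤ 2δ` (`IsGeneric.meanValue_variance_le`). The average of `g(· + k)` over `k` in
`[0, L]` is within mean-square distance `√δ` of `g`. It is also close in mean square to the constant
`M(g)` for large `L`: the squared deviation of a block average is again a function of a finite
window, so its mean along `x` is its expectation, which is small by the law of large numbers
(`IsGeneric.eventually_avg_sq_le`). The inequality passes to the Besicovitch space because a Cauchy
sequence that is asymptotically invariant under each translation is almost invariant uniformly in
`k`, translations being isometries (`IsAlgebraWithMeanValue.isErgodicAlgebra`). -/

noncomputable section

namespace ErgodicFunctions

/-! ### Two-sided Cesàro means of sequences -/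

/-- The enumerations `0, 1, 2, …` and `-1, -2, -3, …` of the two halves of `ℤ`. -/
def halfEnum (s : Bool) (i : ℕ) : ℤ := if s then i else -1 - i

/-- The averages of `b` over the first `p.2` integers in the direction `p.1`. -/
def seqAvg (b : ℤ → ℝ) (p : Bool × ℕ) : ℝ :=
  (∑ i ∈ Finset.range p.2, b (halfEnum p.1 i)) / p.2

/-- `b` has the mean `m` along both halves of `ℤ`. -/
def HasSeqMean (b : ℤ → ℝ) (m : ℝ) : Prop :=
  Tendsto (seqAvg b) ((⊤ : Filter Bool) ×ˢ (atTop : Filter ℕ)) (𝓝 m)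

/-- Both directions are packed into one filter so that a single Cauchy argument yields the same
limit on both halves. Finiteness of `Bool` makes this equivalent to two separate limits. -/
theorem hasSeqMean_iff {b : ℤ → ℝ} {m : ℝ} :
    HasSeqMean b m ↔ ∀ s, Tendsto (fun N : ℕ => (∑ i ∈ Finset.range N, b (halfEnum s i)) / N)
      atTop (𝓝 m) := by
  unfold HasSeqMean
  constructor
  · intro h s
    have h1 : Tendsto (fun N : ℕ => (s, N)) atTop ((⊤ : Filter Bool) ×ˢ (atTop : Filter ℕ)) :=
      tendsto_top.prodMk tendsto_id
    have h2 := Tendsto.comp h h1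
    simpa only [Function.comp_def, seqAvg] using h2
  · intro h U hU
    have h1 : ∀ᶠ N : ℕ in atTop, ∀ s,
        (∑ i ∈ Finset.range N, b (halfEnum s i)) / (N : ℝ) ∈ U :=
      eventually_all.2 fun s => (h s).eventually hU
    have h2 : ∀ᶠ p : Bool × ℕ in (⊤ : Filter Bool) ×ˢ (atTop : Filter ℕ),
        ∀ s, (∑ i ∈ Finset.range p.2, b (halfEnum s i)) / (p.2 : ℝ) ∈ U := h1.prod_inr ⊤
    rw [mem_map]
    filter_upwards [h2] with p hp using hp p.1

/-! ### Linear growth -/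

/-- Moving from `t` to the preceding multiple of `W` changes `G` by a bounded amount, which dies
after division by `t`. The `+ 1` in the hypothesis admits step functions, so that the lemma covers
both integrals and partial sums. -/
theorem tendsto_div_of_tendsto_mul_nat {G : ℝ → ℝ} {C W m : ℝ} (hW : 0 < W)
    (hG : ∀ s ≥ 0, ∀ t ≥ 0, |G t - G s| ≤ C * (|t - s| + 1))
    (h : Tendsto (fun M : ℕ => G (W * M) / M) atTop (𝓝 (W * m))) :
    Tendsto (fun t => G t / t) atTop (𝓝 m) := by
  have hdiv : Tendsto (fun t : ℝ => t / W) atTop atTop := tendsto_id.atTop_div_const hW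
  have hfl : Tendsto (fun t : ℝ => ⌊t / W⌋₊) atTop atTop := tendsto_nat_floor_atTop.comp hdiv
  have h1 : Tendsto (fun t : ℝ => (⌊t / W⌋₊ : ℝ) / (t / W)) atTop (𝓝 1) :=
    (tendsto_nat_floor_div_atTop (R := ℝ)).comp hdiv
  have h2 := ((h.comp hfl).mul h1).mul_const W⁻¹
  have h3 : Tendsto (fun t : ℝ => C * (W + 1) / t) atTop (𝓝 0) :=
    tendsto_const_nhds.div_atTop tendsto_id
  have h4 : Tendsto (fun t : ℝ => G t / t - G (W * ⌊t / W⌋₊) / t) atTop (𝓝 0) := by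
    refine squeeze_zero_norm' ?_ h3
    filter_upwards [eventually_gt_atTop 0] with t ht
    have hC : 0 ≤ C := by
      have := hG 0 le_rfl 0 le_rfl
      simpa using this
    have hq : 0 ≤ t / W := by positivity
    have e1 : W * ⌊t / W⌋₊ ≤ t := by
      have := Nat.floor_le hq
      rw [le_div_iff₀ hW] at this
      linarith
    have e2 : t ≤ W * ⌊t / W⌋₊ + W := by
      have := (Nat.lt_floor_add_one (t / W)).le
      rw [div_le_iff₀ hW] at this
      linarith
    rw [← sub_div, norm_div, Real.norm_eq_abs, Real.norm_of_nonneg ht.le]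
    gcongr
    refine (hG _ (by positivity) _ ht.le).trans ?_
    gcongr
    rw [abs_of_nonneg (by linarith)]
    linarith
  have h5 := h4.add h2
  rw [zero_add, mul_one, mul_comm W m, mul_assoc, mul_inv_cancel₀ hW.ne', mul_one] at h5
  refine h5.congr' ?_
  filter_upwards [eventually_ge_atTop W] with t ht
  have ht0 : 0 < t := hW.trans_le ht
  have hM : (0 : ℝ) < ⌊t / W⌋₊ := by
    exact_mod_cast Nat.floor_pos.2 ((one_le_div hW).2 ht)
  simp only [Function.comp]
  field_simp
  ring

theorem norm_intervalIntegral_sub_le {g : ℝ → ℝ} (hg : Continuous g) {C : ℝ}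
    (hC : ∀ x, |g x| ≤ C) (s t : ℝ) :
    |(∫ u in (0 : ℝ)..t, g u) - ∫ u in (0 : ℝ)..s, g u| ≤ C * |t - s| := by
  rw [intervalIntegral.integral_interval_sub_left (hg.intervalIntegrable _ _)
    (hg.intervalIntegrable _ _)]
  exact intervalIntegral.norm_integral_le_of_norm_le_const (f := g) fun x _ => hC x

theorem intervalIntegral_eq_sum {g : ℝ → ℝ} (hg : Continuous g) (N : ℕ) :
    ∫ u in (0 : ℝ)..N, g u = ∑ i ∈ Finset.range N, ∫ t in (0 : ℝ)..1, g (i + t) := by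
  have := intervalIntegral.sum_integral_adjacent_intervals (f := g) (μ := volume)
    (a := fun i : ℕ => (i : ℝ)) (n := N) (fun k _ => hg.intervalIntegrable _ _)
  simp only [Nat.cast_zero] at this
  rw [← this]
  refine Finset.sum_congr rfl fun i _ => ?_
  rw [intervalIntegral.integral_comp_add_left (fun u => g u)]
  simp

theorem tendsto_integral_div {g : ℝ → ℝ} (hg : Continuous g) {C : ℝ}
    (hC : ∀ x, |g x| ≤ C) {m : ℝ}
    (h : Tendsto (fun N : ℕ => (∑ i ∈ Finset.range N, ∫ t in (0 : ℝ)..1, g (i + t)) / N)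
      atTop (𝓝 m)) :
    Tendsto (fun T => (∫ u in (0 : ℝ)..T, g u) / T) atTop (𝓝 m) := by
  have hC0 : 0 ≤ C := (abs_nonneg _).trans (hC 0)
  refine tendsto_div_of_tendsto_mul_nat (C := C) one_pos (fun s _ t _ => ?_) ?_
  · refine (norm_intervalIntegral_sub_le hg hC s t).trans ?_
    gcongr
    linarith
  · simpa only [one_mul, intervalIntegral_eq_sum hg] using h

theorem tendsto_integral_comp_div_of_pos {g : ℝ → ℝ} {m : ℝ}
    (h : Tendsto (fun T => (∫ u in (0 : ℝ)..T, g u) / T) atTop (𝓝 m)) {c : ℝ} (hc : 0 < c) :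
    Tendsto (fun ε : ℝ => ∫ x in (0 : ℝ)..c, g (x / ε)) (𝓝[>] 0) (𝓝 (c * m)) := by
  have h1 : Tendsto (fun ε : ℝ => c / ε) (𝓝[>] 0) atTop :=
    (tendsto_inv_nhdsGT_zero).const_mul_atTop hc
  refine ((h.comp h1).const_mul c).congr' ?_
  filter_upwards [self_mem_nhdsWithin] with ε hε
  have hε : 0 < ε := hε
  rw [intervalIntegral.integral_comp_div _ hε.ne', zero_div, smul_eq_mul, Function.comp]
  field_simp

theorem tendsto_integral_comp_div {g : ℝ → ℝ} (hg : Continuous g) {C : ℝ}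
    (hC : ∀ x, |g x| ≤ C) {m : ℝ}
    (h : HasSeqMean (fun n : ℤ => ∫ t in (0 : ℝ)..1, g (n + t)) m) (c : ℝ) :
    Tendsto (fun ε : ℝ => ∫ x in (0 : ℝ)..c, g (x / ε)) (𝓝[>] 0) (𝓝 (c * m)) := by
  rw [hasSeqMean_iff] at h
  rcases lt_trichotomy c 0 with hc | rfl | hc
  · have h1 := h false
    have h2 : Tendsto (fun T => (∫ u in (0 : ℝ)..T, g (-u)) / T) atTop (𝓝 m) := by
      refine tendsto_integral_div (hg.comp continuous_neg) (fun x => hC _) (h1.congr fun N => ?_)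
      congr 1
      refine Finset.sum_congr rfl fun i _ => ?_
      -- The reflection `t ↦ 1 - t` identifies the cell `[i, i + 1]` of `g (-·)` with the cell of
      -- `g` starting at `-1 - i`, which is why the negative half is enumerated from `-1`.
      have := intervalIntegral.integral_comp_sub_left (a := 0) (b := 1)
        (fun t => g (-(i + t))) 1
      simp only [sub_zero, sub_self] at this
      simp only [Function.comp]
      rw [← this]
      refine intervalIntegral.integral_congr fun t _ => ?_
      simp only [halfEnum]
      congr 1
      push_cast
      simp
      ring
    have h3 := (tendsto_integral_comp_div_of_pos h2 (neg_pos.2 hc)).neg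
    rw [neg_mul, neg_neg] at h3
    refine h3.congr fun ε => ?_
    have := intervalIntegral.integral_comp_neg (a := 0) (b := -c) (fun x => g (x / ε))
    rw [neg_neg, neg_zero] at this
    simp only [← neg_div]
    rw [this, intervalIntegral.integral_symm, neg_neg]
  · simp
  · refine tendsto_integral_comp_div_of_pos (tendsto_integral_div hg hC ?_) hc
    simpa [halfEnum] using h true

/-! ### From intervals to integrable functions -/

/-- A π-λ argument from half-lines. Disjoint unions are handled by dominated convergence of series,
with bound `C` times the measures of the pieces, which are summable because the measure is
restricted to a bounded interval. -/
theorem tendsto_setIntegral_zero {f : ℝ → ℝ → ℝ} {l : Filter ℝ} {C K : ℝ}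
    (hf : ∀ ε, Continuous (f ε)) (hC : ∀ ε x, |f ε x| ≤ C)
    (h : ∀ a b, Tendsto (fun ε => ∫ x in a..b, f ε x) l (𝓝 0))
    {s : Set ℝ} (hs : MeasurableSet s) :
    Tendsto (fun ε => ∫ x in s, f ε x ∂(volume.restrict (Set.Ioc (-K) K))) l (𝓝 0) := by
  have hint : ∀ ε, Integrable (f ε) (volume.restrict (Set.Ioc (-K) K)) := fun ε =>
    Integrable.of_bound (hf ε).aestronglyMeasurable C (.of_forall (hC ε))
  have hIoc : ∀ u v, Tendsto (fun ε => ∫ x in Set.Ioc u v, f ε x) l (𝓝 0) := fun u v => by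
    rcases le_total u v with huv | huv
    · simpa only [intervalIntegral.integral_of_le huv] using h u v
    · simpa [Set.Ioc_eq_empty_of_le huv] using tendsto_const_nhds
  induction s, hs using MeasurableSpace.induction_on_inter (borel_eq_generateFrom_Iic ℝ)
    isPiSystem_Iic with
  | empty => simpa using tendsto_const_nhds
  | basic s hs =>
    obtain ⟨a, rfl⟩ := hs
    have e : Set.Iic a ∩ Set.Ioc (-K) K = Set.Ioc (-K) (min a K) := by
      ext x
      simp only [Set.mem_inter_iff, Set.mem_Iic, Set.mem_Ioc, le_min_iff]
      tauto
    simp only [Measure.restrict_restrict measurableSet_Iic, e]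
    exact hIoc _ _
  | compl s hs ih =>
    have hu : Tendsto (fun ε => ∫ x, f ε x ∂(volume.restrict (Set.Ioc (-K) K))) l (𝓝 0) :=
      hIoc _ _
    have := hu.sub ih
    rw [sub_zero] at this
    refine this.congr fun ε => ?_
    rw [← integral_add_compl hs (hint ε)]
    ring
  | iUnion s hd hm ih =>
    have e : ∀ ε, ∫ x in ⋃ i, s i, f ε x ∂(volume.restrict (Set.Ioc (-K) K)) =
        ∑' i, ∫ x in s i, f ε x ∂(volume.restrict (Set.Ioc (-K) K)) := fun ε =>
      integral_iUnion hm hd (hint ε).integrableOn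
    simp only [e]
    have := tendsto_tsum_of_dominated_convergence (𝓕 := l)
      (f := fun ε i => ∫ x in s i, f ε x ∂(volume.restrict (Set.Ioc (-K) K)))
      (g := fun _ => 0)
      (bound := fun i => C * (volume.restrict (Set.Ioc (-K) K)).real (s i)) ?_ ih ?_
    · simpa using this
    · refine Summable.mul_left _ ?_
      exact summable_measure_toReal hm hd
    · refine .of_forall fun ε i => ?_
      refine (norm_setIntegral_le_of_norm_le_const ?_ (fun x _ => hC ε x))
      exact measure_lt_top _ _

/-- The functionals `g ↦ ∫ f ε * g` are uniformly bounded on `L¹`, so convergence on indicators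
extends by linearity and density. -/
theorem tendsto_integral_mul_zero {f : ℝ → ℝ → ℝ} {l : Filter ℝ} {C K : ℝ}
    (hf : ∀ ε, Continuous (f ε)) (hC : ∀ ε x, |f ε x| ≤ C)
    (h : ∀ a b, Tendsto (fun ε => ∫ x in a..b, f ε x) l (𝓝 0))
    {g : ℝ → ℝ} (hg : Integrable g (volume.restrict (Set.Ioc (-K) K))) :
    Tendsto (fun ε => ∫ x, f ε x * g x ∂(volume.restrict (Set.Ioc (-K) K))) l (𝓝 0) := by
  have hC0 : 0 ≤ C := (abs_nonneg _).trans (hC 0 0)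
  have hint : ∀ ε {g : ℝ → ℝ}, Integrable g (volume.restrict (Set.Ioc (-K) K)) →
      Integrable (fun x => f ε x * g x) (volume.restrict (Set.Ioc (-K) K)) := fun ε g hg =>
    hg.bdd_mul (hf ε).aestronglyMeasurable (.of_forall (hC ε))
  refine Integrable.induction _ ?_ ?_ ?_ ?_ hg
  · intro c s hs _
    have := (tendsto_setIntegral_zero (K := K) hf hC h hs).mul_const c
    rw [zero_mul] at this
    refine this.congr fun ε => ?_
    rw [← integral_mul_const, ← integral_indicator hs]
    congr 1
    funext x
    by_cases hx : x ∈ s <;> simp [hx]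
  · intro u v _ hf' hg' h1 h2
    have := h1.add h2
    rw [zero_add] at this
    refine this.congr fun ε => ?_
    rw [← integral_add (hint ε hf') (hint ε hg')]
    simp only [Pi.add_apply, mul_add]
  · refine isClosed_of_closure_subset fun g hg => ?_
    simp only [Set.mem_ofPred_eq, Metric.tendsto_nhds]
    intro η hη
    obtain ⟨g', hg', hd⟩ := Metric.mem_closure_iff.1 hg (η / (2 * (C + 1))) (by positivity)
    simp only [Set.mem_ofPred_eq, Metric.tendsto_nhds] at hg'
    filter_upwards [hg' (η / 2) (by positivity)] with ε hε
    rw [Real.dist_eq, sub_zero] at hε ⊢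
    have e1 : |∫ x, f ε x * (g x - g' x) ∂(volume.restrict (Set.Ioc (-K) K))| ≤
        C * dist g g' := by
      rw [L1.dist_eq_integral_dist, ← integral_const_mul]
      refine (Real.norm_eq_abs _).symm.trans_le ?_
      refine norm_integral_le_of_norm_le (g := fun x => C * dist (g x) (g' x)) ?_
        (.of_forall fun x => ?_)
      · refine Integrable.const_mul ?_ _
        simpa only [Real.dist_eq, Real.norm_eq_abs, Pi.sub_apply] using ((L1.integrable_coeFn g).sub (L1.integrable_coeFn g')).norm
      · rw [norm_mul, Real.dist_eq]
        exact mul_le_mul_of_nonneg_right (hC ε x) (abs_nonneg _)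
    have e2 : C * dist g g' < η / 2 := by
      calc C * dist g g' ≤ (C + 1) * dist g g' := by gcongr; linarith
        _ < (C + 1) * (η / (2 * (C + 1))) := by gcongr
        _ = η / 2 := by field_simp
    have e3 : ∫ x, f ε x * g x ∂(volume.restrict (Set.Ioc (-K) K)) =
        (∫ x, f ε x * (g x - g' x) ∂(volume.restrict (Set.Ioc (-K) K))) +
          ∫ x, f ε x * g' x ∂(volume.restrict (Set.Ioc (-K) K)) := by
      have hsub : Integrable (fun x => g x - g' x) (volume.restrict (Set.Ioc (-K) K)) :=
        (L1.integrable_coeFn g).sub (L1.integrable_coeFn g')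
      rw [← integral_add (hint ε hsub) (hint ε (L1.integrable_coeFn g'))]
      congr 1
      funext x
      ring
    rw [e3]
    exact (abs_add_le _ _).trans_lt (by linarith)
  · intro u v hfg _ h1
    refine h1.congr fun ε => integral_congr_ae ?_
    filter_upwards [hfg] with x hx
    rw [hx]

theorem hasMeanValue_of_hasSeqMean {g : ℝ → ℝ} (hg : Continuous g) {C : ℝ}
    (hC : ∀ x, |g x| ≤ C) {m : ℝ}
    (h : HasSeqMean (fun n : ℤ => ∫ t in (0 : ℝ)..1, g (n + t)) m) : HasMeanValue g m := by
  intro k hk hkc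
  obtain ⟨K, hK⟩ : ∃ K : ℝ, ∀ x, x ∉ Set.Ioc (-K) K → k x = 0 := by
    obtain ⟨K, hK⟩ := hkc.isCompact.isBounded.subset_ball 0
    refine ⟨K, fun x hx => ?_⟩
    by_contra h0
    have := hK (subset_tsupport k h0)
    rw [Metric.mem_ball, dist_zero_right, Real.norm_eq_abs, abs_lt] at this
    exact hx ⟨this.1, this.2.le⟩
  have hki : Integrable k (volume.restrict (Set.Ioc (-K) K)) :=
    (hk.restrict _).integrable le_top
  have hres : ∀ F : ℝ → ℝ, ∫ x, F x * k x = ∫ x, F x * k x ∂(volume.restrict (Set.Ioc (-K) K)) :=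
    fun F => (setIntegral_eq_integral_of_forall_compl_eq_zero fun x hx => by rw [hK x hx, mul_zero]).symm
  have h0 : Tendsto (fun ε => ∫ x, (g (x / ε) - m) * k x ∂(volume.restrict (Set.Ioc (-K) K)))
      (𝓝[>] 0) (𝓝 0) := by
    refine tendsto_integral_mul_zero (C := C + |m|) (fun ε => by fun_prop) (fun ε x => ?_)
      (fun a b => ?_) hki
    · exact (abs_sub _ _).trans (add_le_add_left (hC _) _)
    · have h1 := (tendsto_integral_comp_div hg hC h b).sub (tendsto_integral_comp_div hg hC h a)
      have h2 := h1.sub_const ((b - a) * m)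
      rw [← sub_mul, sub_self] at h2
      refine h2.congr fun ε => ?_
      have hi : ∀ u v, IntervalIntegrable (fun x => g (x / ε)) volume u v := fun u v =>
        Continuous.intervalIntegrable (by fun_prop) _ _
      rw [intervalIntegral.integral_sub (hi _ _) (by simp),
        intervalIntegral.integral_interval_sub_left (hi _ _) (hi _ _)]
      simp
  have h1 := h0.add_const (m * ∫ x, k x ∂(volume.restrict (Set.Ioc (-K) K)))
  rw [zero_add] at h1
  have e0 : ∫ x, k x = ∫ x, k x ∂(volume.restrict (Set.Ioc (-K) K)) := by
    simpa using hres fun _ => 1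
  rw [e0]
  refine h1.congr fun ε => ?_
  rw [hres, ← integral_const_mul, ← integral_add]
  · congr 1
    funext x
    ring
  · refine hki.bdd_mul (c := C + |m|) (by fun_prop) (.of_forall fun x => ?_)
    exact (abs_sub _ _).trans (add_le_add_left (hC _) _)
  · exact hki.const_mul m

/-- The averages of `f` over `[0, N]`. -/
def intervalAvg (f : ℝ → ℝ) (N : ℕ) : ℝ := (∫ t in (0 : ℝ)..N, f t) / N

/-- Test against the indicator of `(0, 1]` along `ε = 1 / N`. Once a mean value is known to exist,
this one-sided limit computes it, so linearity, monotonicity and translation invariance can be read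
off from averages over `[0, N]`. -/
theorem HasMeanValue.tendsto_intervalAvg {f : ℝ → ℝ} {m : ℝ} (h : HasMeanValue f m) :
    Tendsto (intervalAvg f) atTop (𝓝 m) := by
  have hg : MemLp (Set.indicator (Set.Ioc (0 : ℝ) 1) (fun _ => (1 : ℝ))) ⊤ volume :=
    memLp_indicator_const ⊤ measurableSet_Ioc 1 (Or.inr (by simp))
  have hc : HasCompactSupport (Set.indicator (Set.Ioc (0 : ℝ) 1) (fun _ => (1 : ℝ))) :=
    HasCompactSupport.intro (K := Set.Icc (0 : ℝ) 1) isCompact_Icc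
      (fun x hx => Set.indicator_of_notMem (fun h => hx (Set.Ioc_subset_Icc_self h)) _)
  have hi : ∫ x, Set.indicator (Set.Ioc (0 : ℝ) 1) (fun _ => (1 : ℝ)) x = 1 := by
    rw [integral_indicator measurableSet_Ioc]; simp
  have h1 := h _ hg hc
  rw [hi, mul_one] at h1
  have h2 : Tendsto (fun N : ℕ => (N : ℝ)⁻¹) atTop (𝓝[>] 0) :=
    tendsto_inv_atTop_nhdsGT_zero.comp tendsto_natCast_atTop_atTop
  refine (h1.comp h2).congr' ?_
  filter_upwards [eventually_gt_atTop 0] with N hN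
  have hN : (0 : ℝ) < N := by exact_mod_cast hN
  have e : ∀ x, f (x / (N : ℝ)⁻¹) * Set.indicator (Set.Ioc (0 : ℝ) 1) (fun _ => (1 : ℝ)) x =
      Set.indicator (Set.Ioc (0 : ℝ) 1) (fun x => f (x / (N : ℝ)⁻¹)) x := fun x => by
    by_cases hx : x ∈ Set.Ioc (0 : ℝ) 1 <;> simp [hx]
  simp only [Function.comp, e, intervalAvg]
  rw [integral_indicator measurableSet_Ioc, ← intervalIntegral.integral_of_le zero_le_one,
    intervalIntegral.integral_comp_div _ (inv_pos.2 hN).ne']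
  simp [div_eq_inv_mul]

/-! ### Windows of sequences and the law of large numbers -/

/-- The shift by `n` on the sequence space. -/
def shiftSeq (n : ℤ) (x : SeqSpace) : SeqSpace := fun i => x (n + i)

/-- Words indexed by `{-R, …, R}`. -/
abbrev Window (R : ℕ) : Type := Finset.Icc (-R : ℤ) R → TwoPoint

/-- The restriction of a sequence to `{-R, …, R}`. -/
def window (R : ℕ) (x : SeqSpace) : Window R := fun i => x i

theorem measurable_shiftSeq (n : ℤ) : Measurable (shiftSeq n) :=
  measurable_pi_lambda _ fun _ => measurable_pi_apply _

theorem measurable_window (R : ℕ) : Measurable (window R) :=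
  measurable_pi_lambda _ fun _ => measurable_pi_apply _

theorem measurable_comp_window {R : ℕ} (Φ : Window R → ℝ) : Measurable fun x => Φ (window R x) :=
  (measurable_of_finite Φ).comp (measurable_window R)

theorem map_shiftSeq (q : ℝ) [IsProbabilityMeasure (twoPointMeasure q)] (n : ℤ) :
    (seqMeasure q).map (shiftSeq n) = seqMeasure q :=
  Measure.map_infinitePi_infinitePi_of_inj (P := fun _ : ℤ => twoPointMeasure q)
    (f := fun i => n + i) (add_right_injective n)

instance isProbabilityMeasure_seqMeasure (q : ℝ) [IsProbabilityMeasure (twoPointMeasure q)] :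
    IsProbabilityMeasure (seqMeasure q) := by
  unfold seqMeasure
  infer_instance

theorem exists_abs_le_of_window {R : ℕ} (Φ : Window R → ℝ) : ∃ C, ∀ w, |Φ w| ≤ C := by
  obtain ⟨C, hC⟩ := Set.finite_range (fun w => |Φ w|) |>.bddAbove
  exact ⟨C, fun w => hC ⟨w, rfl⟩⟩

theorem integrable_comp_window (q : ℝ) [IsProbabilityMeasure (twoPointMeasure q)] {R : ℕ}
    (Φ : Window R → ℝ) : Integrable (fun x => Φ (window R x)) (seqMeasure q) := by
  obtain ⟨C, hC⟩ := exists_abs_le_of_window Φ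
  exact .of_bound (measurable_comp_window Φ).aestronglyMeasurable C (.of_forall fun x => hC _)

theorem indepFun_window_shiftSeq (q : ℝ) [IsProbabilityMeasure (twoPointMeasure q)] (R : ℕ)
    {n m : ℤ} (h : 2 * R < |n - m|) :
    ProbabilityTheory.IndepFun (fun x => window R (shiftSeq n x))
      (fun x => window R (shiftSeq m x)) (seqMeasure q) := by
  have hd : Disjoint (Finset.Icc (n - R) (n + R)) (Finset.Icc (m - R) (m + R)) := by
    rw [Finset.disjoint_left]
    intro i hi hj
    rw [Finset.mem_Icc] at hi hj
    rcases abs_cases (n - m) with ⟨h1, _⟩ | ⟨h1, _⟩ <;> omega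
  have hi := (ProbabilityTheory.iIndepFun_infinitePi (P := fun _ : ℤ => twoPointMeasure q)
    (X := fun _ a => a) (fun _ => measurable_id)).indepFun_finset _ _ hd
    (fun i => measurable_pi_apply i)
  have hw : ∀ k : ℤ, ∀ i : Finset.Icc (-R : ℤ) R, k + (i : ℤ) ∈ Finset.Icc (k - R) (k + R) := by
    rintro k ⟨i, hi⟩
    rw [Finset.mem_Icc] at hi ⊢
    simp only
    omega
  exact hi.comp
    (φ := fun (w : Finset.Icc (n - R : ℤ) (n + R) → TwoPoint) (i : Finset.Icc (-R : ℤ) R) =>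
      w ⟨n + i, hw n i⟩)
    (ψ := fun (w : Finset.Icc (m - R : ℤ) (m + R) → TwoPoint) (i : Finset.Icc (-R : ℤ) R) =>
      w ⟨m + i, hw m i⟩)
    (measurable_of_finite _) (measurable_of_finite _)

theorem sum_range_mul_residues (b : ℕ → ℝ) (W M : ℕ) :
    ∑ i ∈ Finset.range (W * M), b i =
      ∑ r ∈ Finset.range W, ∑ k ∈ Finset.range M, b (W * k + r) := by
  induction M with
  | zero => simp
  | succ M ih =>
    simp only [Nat.mul_succ, Finset.sum_range_add, ih, Finset.sum_range_succ, Finset.sum_add_distrib]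

/-- Along multiples of `W` the sum splits exactly into the `W` residue classes; boundedness fills in
the remaining lengths. -/
theorem tendsto_cesaro_of_residues {b : ℕ → ℝ} {C : ℝ} (hb : ∀ i, |b i| ≤ C) {W : ℕ} (hW : 0 < W)
    {m : ℝ} (h : ∀ r, Tendsto (fun M : ℕ => (∑ k ∈ Finset.range M, b (W * k + r)) / M)
      atTop (𝓝 m)) :
    Tendsto (fun N : ℕ => (∑ i ∈ Finset.range N, b i) / N) atTop (𝓝 m) := by
  have hC : 0 ≤ C := (abs_nonneg _).trans (hb 0)
  have hdiff : ∀ n k : ℕ, |∑ i ∈ Finset.range (n + k), b i - ∑ i ∈ Finset.range n, b i| ≤ C * k := by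
    intro n k
    rw [Finset.sum_range_add, add_sub_cancel_left]
    refine (Finset.abs_sum_le_sum_abs _ _).trans ?_
    refine (Finset.sum_le_card_nsmul _ _ C fun i _ => hb _).trans ?_
    simp [mul_comm]
  have hmono : ∀ s t : ℝ, 0 ≤ s → s ≤ t →
      |∑ i ∈ Finset.range ⌊t⌋₊, b i - ∑ i ∈ Finset.range ⌊s⌋₊, b i| ≤ C * (|t - s| + 1) := by
    intro s t hs hst
    have hle : ⌊s⌋₊ ≤ ⌊t⌋₊ := Nat.floor_le_floor hst
    obtain ⟨k, hk⟩ := Nat.exists_eq_add_of_le hle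
    rw [hk]
    refine (hdiff _ _).trans ?_
    gcongr
    have h1 := Nat.floor_le (hs.trans hst)
    have h2 := Nat.lt_floor_add_one s
    have h3 : ((⌊t⌋₊ : ℕ) : ℝ) = ⌊s⌋₊ + k := by rw [hk]; push_cast; ring
    rw [abs_of_nonneg (by linarith)]
    linarith
  have key := tendsto_div_of_tendsto_mul_nat
    (G := fun t : ℝ => ∑ i ∈ Finset.range ⌊t⌋₊, b i) (C := C) (W := W) (m := m)
    (by exact_mod_cast hW) ?_ ?_
  · have := key.comp tendsto_natCast_atTop_atTop
    simpa [Function.comp_def] using this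
  · intro s hs t ht
    rcases le_total s t with hst | hst
    · exact hmono s t hs hst
    · rw [abs_sub_comm, abs_sub_comm t s]
      exact hmono t s ht hst
  · have h1 := tendsto_finsetSum (Finset.range W) fun r _ => h r
    simp only [Finset.sum_const, Finset.card_range, nsmul_eq_mul] at h1
    refine h1.congr fun M => ?_
    rw [← Nat.cast_mul, Nat.floor_natCast, sum_range_mul_residues, Finset.sum_div]

/-- Neighbouring windows overlap and are dependent, but windows at distance greater than `2 * R` use
disjoint coordinates. The strong law therefore applies on each residue class modulo `2 * R + 1`. -/
theorem ae_tendsto_window (q : ℝ) [IsProbabilityMeasure (twoPointMeasure q)] {R : ℕ}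
    (Φ : Window R → ℝ) (s : Bool) :
    ∀ᵐ x ∂seqMeasure q,
      Tendsto (fun N : ℕ => (∑ i ∈ Finset.range N,
        Φ (window R (shiftSeq (halfEnum s i) x))) / N) atTop
        (𝓝 (∫ y, Φ (window R y) ∂seqMeasure q)) := by
  obtain ⟨C, hC⟩ := exists_abs_le_of_window Φ
  have hW : 0 < 2 * R + 1 := by omega
  have hmap : ∀ n, (seqMeasure q).map (fun x => Φ (window R (shiftSeq n x))) =
      (seqMeasure q).map (fun x => Φ (window R x)) := fun n => by
    conv_rhs => rw [← map_shiftSeq q n]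
    rw [Measure.map_map (measurable_comp_window Φ) (measurable_shiftSeq n)]
    rfl
  have hmeas : ∀ n, Measurable fun x => Φ (window R (shiftSeq n x)) := fun n =>
    (measurable_comp_window Φ).comp (measurable_shiftSeq n)
  have hr : ∀ r : ℕ, ∀ᵐ x ∂seqMeasure q,
      Tendsto (fun M : ℕ => (∑ k ∈ Finset.range M,
        Φ (window R (shiftSeq (halfEnum s ((2 * R + 1) * k + r)) x))) / M) atTop
        (𝓝 (∫ y, Φ (window R y) ∂seqMeasure q)) := by
    intro r
    have hid : ∀ n m, ProbabilityTheory.IdentDistrib (fun x => Φ (window R (shiftSeq n x)))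
        (fun x => Φ (window R (shiftSeq m x))) (seqMeasure q) (seqMeasure q) := fun n m =>
      ⟨(hmeas n).aemeasurable, (hmeas m).aemeasurable, by rw [hmap, hmap]⟩
    have key := ProbabilityTheory.strong_law_ae_real (μ := seqMeasure q)
      (fun k x => Φ (window R (shiftSeq (halfEnum s ((2 * R + 1) * k + r)) x)))
      (.of_bound (hmeas _).aestronglyMeasurable C (.of_forall fun x => hC _)) ?_
      (fun i => hid _ _)
    · have e : ∫ x, Φ (window R (shiftSeq (halfEnum s ((2 * R + 1) * 0 + r)) x)) ∂seqMeasure q =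
          ∫ y, Φ (window R y) ∂seqMeasure q := by
        have := integral_map (μ := seqMeasure q) (measurable_shiftSeq
          (halfEnum s ((2 * R + 1) * 0 + r))).aemeasurable
          (measurable_comp_window Φ).aestronglyMeasurable
        rw [map_shiftSeq] at this
        exact this.symm
      rwa [e] at key
    · intro k l hkl
      have hdist : 2 * (R : ℤ) < |halfEnum s ((2 * R + 1) * k + r) -
          halfEnum s ((2 * R + 1) * l + r)| := by
        have e : |halfEnum s ((2 * R + 1) * k + r) - halfEnum s ((2 * R + 1) * l + r)| =
            (2 * R + 1 : ℤ) * |(k : ℤ) - l| := by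
          rw [← abs_of_nonneg (show (0 : ℤ) ≤ 2 * R + 1 by positivity), ← abs_mul]
          cases s
          · rw [← abs_neg]
            congr 1
            simp only [halfEnum]
            push_cast
            simp
            ring
          · congr 1
            simp only [halfEnum]
            push_cast
            simp
            ring
        rw [e]
        have h1 : 1 ≤ |(k : ℤ) - l| := Int.one_le_abs (sub_ne_zero.2 (by exact_mod_cast hkl))
        nlinarith
      exact (indepFun_window_shiftSeq q R hdist).comp (measurable_of_finite Φ)
        (measurable_of_finite Φ)
  filter_upwards [ae_all_iff.2 hr] with x hx
  exact tendsto_cesaro_of_residues (fun i => hC _) hW hx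

/-- A sequence is generic if the frequencies of its words, in both directions, are their
probabilities. -/
def IsGeneric (q : ℝ) (x : SeqSpace) : Prop :=
  ∀ (R : ℕ) (Φ : Window R → ℝ),
    HasSeqMean (fun n => Φ (window R (shiftSeq n x))) (∫ y, Φ (window R y) ∂seqMeasure q)

/-- There are uncountably many `Φ`, but each is a linear combination of indicators of words, and
there are only countably many words. -/
theorem ae_isGeneric (q : ℝ) [IsProbabilityMeasure (twoPointMeasure q)] :
    ∀ᵐ x ∂seqMeasure q, IsGeneric q x := by
  classical
  have h : ∀ᵐ x ∂seqMeasure q, ∀ (R : ℕ) (p : Window R) (s : Bool),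
      Tendsto (fun N : ℕ => (∑ i ∈ Finset.range N,
        if window R (shiftSeq (halfEnum s i) x) = p then (1 : ℝ) else 0) / N) atTop
        (𝓝 (∫ y, (if window R y = p then (1 : ℝ) else 0) ∂seqMeasure q)) := by
    simp only [ae_all_iff]
    exact fun R p s => ae_tendsto_window q (fun w => if w = p then (1 : ℝ) else 0) s
  filter_upwards [h] with x hx R Φ
  have := Fintype.ofFinite (Window R)
  have e : ∀ w, Φ w = ∑ p, Φ p * if w = p then (1 : ℝ) else 0 := fun w => by simp
  rw [hasSeqMean_iff]
  intro s
  have h1 := tendsto_finsetSum Finset.univ fun p _ => (hx R p s).const_mul (Φ p)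
  have e2 : ∫ y, Φ (window R y) ∂seqMeasure q =
      ∑ p, Φ p * ∫ y, (if window R y = p then (1 : ℝ) else 0) ∂seqMeasure q := by
    simp only [← integral_const_mul]
    rw [← integral_finsetSum]
    · exact integral_congr_ae (.of_forall fun y => e _)
    · exact fun p _ => (integrable_comp_window q fun w => if w = p then (1 : ℝ) else 0).const_mul _
  rw [e2]
  refine h1.congr fun N => ?_
  simp only [← mul_div_assoc, ← Finset.sum_div, Finset.mul_sum]
  rw [Finset.sum_comm]
  congr 1
  exact Finset.sum_congr rfl fun i _ => (e _).symm

/-- The law of large numbers in mean square. -/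
theorem tendsto_integral_sq_window (q : ℝ) [IsProbabilityMeasure (twoPointMeasure q)] {R : ℕ}
    (Φ : Window R → ℝ) :
    Tendsto (fun L : ℕ => ∫ y, ((∑ j ∈ Finset.range L, Φ (window R (shiftSeq j y))) / L -
      ∫ z, Φ (window R z) ∂seqMeasure q) ^ 2 ∂seqMeasure q) atTop (𝓝 0) := by
  obtain ⟨C, hC⟩ := exists_abs_le_of_window Φ
  have hC0 : 0 ≤ C := (abs_nonneg _).trans (hC (fun _ => ⟨1, by simp⟩))
  have hm : |∫ z, Φ (window R z) ∂seqMeasure q| ≤ C := by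
    simpa using norm_integral_le_of_norm_le_const (μ := seqMeasure q)
      (f := fun z => Φ (window R z)) (.of_forall fun z => hC _)
  rw [show (𝓝 (0 : ℝ)) = 𝓝 (∫ _ : SeqSpace, (0 : ℝ) ∂seqMeasure q) by simp]
  refine tendsto_integral_of_dominated_convergence (fun _ => (C + C) ^ 2) (fun L => ?_)
    (integrable_const _) (fun L => .of_forall fun y => ?_) ?_
  · refine Measurable.aestronglyMeasurable ?_
    refine Measurable.pow_const (Measurable.sub_const (Measurable.div_const ?_ _) _) _
    exact Finset.measurable_sum _ fun j _ =>
      (measurable_comp_window Φ).comp (measurable_shiftSeq j)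
  · rw [norm_pow, Real.norm_eq_abs]
    gcongr
    refine (abs_sub _ _).trans (add_le_add ?_ hm)
    rw [abs_div, Nat.abs_cast]
    refine div_le_of_le_mul₀ (by positivity) hC0 ?_
    refine (Finset.abs_sum_le_sum_abs _ _).trans ?_
    refine (Finset.sum_le_card_nsmul _ _ C fun i _ => hC _).trans ?_
    simp [mul_comm]
  · filter_upwards [ae_tendsto_window q Φ true] with y hy
    have := (hy.sub_const (∫ z, Φ (window R z) ∂seqMeasure q)).pow 2
    simpa [halfEnum] using this

/-! ### Local sequences -/

theorem window_eq_iff {R : ℕ} {x y : SeqSpace} :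
    window R x = window R y ↔ ∀ i : ℤ, |i| ≤ R → x i = y i := by
  constructor
  · intro h i hi
    exact congrFun h ⟨i, Finset.mem_Icc.2 (abs_le.1 hi)⟩
  · intro h
    funext i
    exact h i (abs_le.2 (Finset.mem_Icc.1 i.2))

theorem window_eq_of_le {R S : ℕ} (h : R ≤ S) {x y : SeqSpace} (hxy : window S x = window S y) :
    window R x = window R y := by
  rw [window_eq_iff] at hxy ⊢
  exact fun i hi => hxy i (hi.trans (by exact_mod_cast h))

/-- `a n` is determined, up to an arbitrarily small error, by a word of `x` around `n`. -/
def IsLocalSeq (x : SeqSpace) (a : ℤ → ℝ) : Prop :=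
  ∀ ε > 0, ∃ R : ℕ, ∀ n m, window R (shiftSeq n x) = window R (shiftSeq m x) → |a n - a m| ≤ ε

theorem IsLocalSeq.exists_window_approx {x : SeqSpace} {a : ℤ → ℝ} (ha : IsLocalSeq x a) {ε : ℝ}
    (hε : 0 < ε) :
    ∃ (R : ℕ) (Φ : Window R → ℝ), ∀ n, |a n - Φ (window R (shiftSeq n x))| ≤ ε := by
  classical
  obtain ⟨R, hR⟩ := ha ε hε
  -- Each word takes the value of `a` at one chosen occurrence; the value `0` on words that do not
  -- occur in `x` is never used.
  refine ⟨R, fun w => if h : ∃ n, window R (shiftSeq n x) = w then a h.choose else 0, fun n => ?_⟩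
  have h : ∃ m, window R (shiftSeq m x) = window R (shiftSeq n x) := ⟨n, rfl⟩
  simp only [dif_pos h]
  exact hR _ _ h.choose_spec.symm

theorem abs_seqAvg_sub_le {a b : ℤ → ℝ} {ε : ℝ} (h : ∀ n, |a n - b n| ≤ ε) (p : Bool × ℕ) :
    |seqAvg a p - seqAvg b p| ≤ ε := by
  have hε : 0 ≤ ε := (abs_nonneg _).trans (h 0)
  rw [seqAvg, seqAvg, ← sub_div, ← Finset.sum_sub_distrib, abs_div, Nat.abs_cast]
  refine div_le_of_le_mul₀ (by positivity) hε ?_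
  refine (Finset.abs_sum_le_sum_abs _ _).trans ?_
  refine (Finset.sum_le_card_nsmul _ _ ε fun i _ => h _).trans ?_
  simp [mul_comm]

/-- The averages of `a` stay within `ε / 4` of those of a window function, which converge; hence
they are Cauchy. -/
theorem IsGeneric.exists_hasSeqMean {q : ℝ} {x : SeqSpace} (hx : IsGeneric q x) {a : ℤ → ℝ}
    (ha : IsLocalSeq x a) : ∃ m, HasSeqMean a m := by
  have hne : (map (seqAvg a) ((⊤ : Filter Bool) ×ˢ (atTop : Filter ℕ))).NeBot := inferInstance
  refine cauchy_map_iff_exists_tendsto.1 (Metric.cauchy_iff.2 ⟨hne, fun ε hε => ?_⟩)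
  obtain ⟨R, Φ, hΦ⟩ := ha.exists_window_approx (ε := ε / 4) (by positivity)
  refine ⟨Metric.ball (∫ y, Φ (window R y) ∂seqMeasure q) (ε / 2), ?_, fun s hs t ht => ?_⟩
  · rw [mem_map]
    filter_upwards [Metric.tendsto_nhds.1 (hx R Φ) (ε / 4) (by positivity)] with p hp
    rw [Set.mem_preimage, Metric.mem_ball]
    have h1 := abs_seqAvg_sub_le hΦ p
    rw [← Real.dist_eq] at h1
    linarith [dist_triangle (seqAvg a p) (seqAvg (fun n => Φ (window R (shiftSeq n x))) p)
      (∫ y, Φ (window R y) ∂seqMeasure q)]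
  · rw [Metric.mem_ball] at hs ht
    linarith [dist_triangle_right s t (∫ y, Φ (window R y) ∂seqMeasure q)]

/-- The average over `{0, …, L - 1}` of a function of the windows is a function of a larger
window. -/
theorem exists_window_avg {R : ℕ} (Φ : Window R → ℝ) (L : ℕ) (m : ℝ) :
    ∃ Ψ : Window (R + L) → ℝ, ∀ y, Ψ (window (R + L) y) =
      ((∑ j ∈ Finset.range L, Φ (window R (shiftSeq j y))) / L - m) ^ 2 := by
  have hmem : ∀ j : Finset.range L, ∀ i : Finset.Icc (-R : ℤ) R,
      ((j : ℕ) : ℤ) + i ∈ Finset.Icc (-(R + L : ℕ) : ℤ) (R + L : ℕ) := by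
    rintro ⟨j, hj⟩ ⟨i, hi⟩
    simp only [Finset.mem_range, Finset.mem_Icc] at hj hi ⊢
    push_cast
    omega
  refine ⟨fun w => ((∑ j : Finset.range L, Φ fun i => w ⟨_, hmem j i⟩) / L - m) ^ 2, fun y => ?_⟩
  rw [← Finset.sum_coe_sort (Finset.range L)]
  rfl

/-- The ergodic input. After replacing `a` by a window function, the squared deviation of an
`L`-block average depends on a window of radius `R + L`. For fixed `L`, genericity turns its average
over `n` into an expectation, which the mean-square law of large numbers makes small. -/
theorem IsGeneric.eventually_avg_sq_le {q : ℝ} [IsProbabilityMeasure (twoPointMeasure q)]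
    {x : SeqSpace} (hx : IsGeneric q x) {a : ℤ → ℝ} (ha : IsLocalSeq x a) {m : ℝ}
    (hm : HasSeqMean a m) {η : ℝ} (hη : 0 < η) (L₀ : ℕ) :
    ∃ L ≥ L₀, ∀ᶠ N : ℕ in atTop, (∑ n ∈ Finset.range N,
      ((∑ j ∈ Finset.range L, a (n + j)) / L - m) ^ 2) / N ≤ η := by
  -- Replacing `a` and `m` by `Φ` and `m'` costs at most `2 * δ` before squaring, hence `2 * (2 * δ)
  -- ^ 2 = η / 2` after it; the other half of `η` is twice the bound `η / 4` on the expectation.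
  set δ := Real.sqrt (η / 16) with hδ
  have hδ0 : 0 < δ := Real.sqrt_pos.2 (by positivity)
  have hδ2 : δ ^ 2 = η / 16 := Real.sq_sqrt (by positivity)
  obtain ⟨R, Φ, hΦ⟩ := ha.exists_window_approx hδ0
  set m' := ∫ y, Φ (window R y) ∂seqMeasure q with hm'
  have hmm : |m - m'| ≤ δ :=
    le_of_tendsto (hm.sub (hx R Φ)).abs (.of_forall fun p => abs_seqAvg_sub_le hΦ p)
  obtain ⟨L, hL, hL0⟩ := (((tendsto_integral_sq_window q Φ).eventually
    (gt_mem_nhds (show 0 < η / 4 by positivity))).and (eventually_ge_atTop L₀)).exists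
  refine ⟨L, hL0, ?_⟩
  obtain ⟨Ψ, hΨ⟩ := exists_window_avg Φ L m'
  have h1 := hasSeqMean_iff.1 (hx (R + L) Ψ) true
  simp only [hΨ] at h1
  filter_upwards [h1.eventually (gt_mem_nhds hL)] with N hN
  have hpt : ∀ n : ℕ, ((∑ j ∈ Finset.range L, a (n + j)) / L - m) ^ 2 ≤
      2 * ((∑ j ∈ Finset.range L, Φ (window R (shiftSeq j (shiftSeq (halfEnum true n) x)))) / L
        - m') ^ 2 + η / 2 := by
    intro n
    set A := (∑ j ∈ Finset.range L, a (n + j)) / (L : ℝ)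
    set B := (∑ j ∈ Finset.range L,
      Φ (window R (shiftSeq j (shiftSeq (halfEnum true n) x)))) / (L : ℝ) with hB
    have hAB : |A - B| ≤ δ := by
      have := abs_seqAvg_sub_le (a := fun j => a (n + j))
        (b := fun j => Φ (window R (shiftSeq (n + j) x))) (fun j => hΦ _) (true, L)
      have e : ∀ j : ℕ, shiftSeq j (shiftSeq (n : ℤ) x) = shiftSeq (n + j) x := fun j => by
        funext i
        simp only [shiftSeq, add_assoc]
      simpa [seqAvg, halfEnum, A, B, e] using this
    have h2 := sq_nonneg ((A - m) - 2 * (B - m'))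
    have h3 : |(A - B) - (m - m')| ≤ δ + δ := (abs_sub _ _).trans (add_le_add hAB hmm)
    have h4 : ((A - B) - (m - m')) ^ 2 ≤ (δ + δ) ^ 2 := sq_le_sq' (abs_le.1 h3).1 (abs_le.1 h3).2
    nlinarith
  have hN0 : (0 : ℝ) ≤ N := Nat.cast_nonneg N
  calc (∑ n ∈ Finset.range N, ((∑ j ∈ Finset.range L, a (n + j)) / L - m) ^ 2) / (N : ℝ)
      ≤ (∑ n ∈ Finset.range N, (2 * ((∑ j ∈ Finset.range L,
          Φ (window R (shiftSeq j (shiftSeq (halfEnum true n) x)))) / L - m') ^ 2 + η / 2)) / N := by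
        gcongr with n _
        exact hpt n
    _ = 2 * ((∑ n ∈ Finset.range N, ((∑ j ∈ Finset.range L,
          Φ (window R (shiftSeq j (shiftSeq (halfEnum true n) x)))) / L - m') ^ 2) / N) +
          (N * (η / 2)) / N := by
        rw [Finset.sum_add_distrib, add_div, ← Finset.mul_sum, mul_div_assoc]
        simp
    _ ≤ 2 * (η / 4) + η / 2 := by
        refine add_le_add (by linarith) ?_
        exact div_le_of_le_mul₀ hN0 (by positivity) (le_of_eq (mul_comm _ _))
    _ = η := by ring

/-! ### The mean value on an algebra with mean value -/

@[simp]
theorem translate_apply (k : ℝ) (f : ℝ →ᵇ ℝ) (x : ℝ) : translate k f x = f (x + k) := rfl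

theorem intervalAvg_mono {f g : ℝ → ℝ} (hf : Continuous f) (hg : Continuous g)
    (h : ∀ x, f x ≤ g x) (N : ℕ) : intervalAvg f N ≤ intervalAvg g N := by
  unfold intervalAvg
  gcongr
  exact intervalIntegral.integral_mono (by positivity) (hf.intervalIntegrable _ _)
    (hg.intervalIntegrable _ _) h

theorem intervalAvg_add {f g : ℝ → ℝ} (hf : Continuous f) (hg : Continuous g) (N : ℕ) :
    intervalAvg (fun x => f x + g x) N = intervalAvg f N + intervalAvg g N := by
  unfold intervalAvg
  rw [intervalIntegral.integral_add (hf.intervalIntegrable _ _) (hg.intervalIntegrable _ _),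
    add_div]

theorem intervalAvg_const_mul (f : ℝ → ℝ) (c : ℝ) (N : ℕ) :
    intervalAvg (fun x => c * f x) N = c * intervalAvg f N := by
  unfold intervalAvg
  rw [intervalIntegral.integral_const_mul, mul_div_assoc]

/-- The integrals over `[k, N + k]` and `[0, N]` differ only by two end pieces of length `|k|`. -/
theorem tendsto_intervalAvg_translate_sub (f : ℝ →ᵇ ℝ) (k : ℝ) :
    Tendsto (fun N => intervalAvg (translate k f) N - intervalAvg f N) atTop (𝓝 0) := by
  have h : Tendsto (fun N : ℕ => (‖f‖ * |k| + ‖f‖ * |k|) / (N : ℝ)) atTop (𝓝 0) :=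
    tendsto_const_nhds.div_atTop tendsto_natCast_atTop_atTop
  refine squeeze_zero_norm (fun N => ?_) h
  have hC : ∀ x, |f x| ≤ ‖f‖ := fun x => f.norm_coe_le_norm x
  have hi : ∀ a b, IntervalIntegrable f volume a b := fun a b =>
    f.continuous.intervalIntegrable _ _
  unfold intervalAvg
  simp only [translate_apply]
  rw [intervalIntegral.integral_comp_add_right (fun x => f x), ← sub_div, norm_div,
    Real.norm_natCast, Real.norm_eq_abs]
  gcongr
  have e : (∫ x in (0 + k)..(N + k), f x) - ∫ x in (0 : ℝ)..N, f x =
      ((∫ x in (0 : ℝ)..(N + k), f x) - ∫ x in (0 : ℝ)..N, f x) -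
        ((∫ x in (0 : ℝ)..k, f x) - ∫ x in (0 : ℝ)..0, f x) := by
    rw [zero_add, ← intervalIntegral.integral_add_adjacent_intervals (hi 0 k) (hi k (N + k)),
      intervalIntegral.integral_same]
    ring
  rw [e]
  refine (abs_sub _ _).trans (add_le_add ?_ ?_)
  · simpa using norm_intervalIntegral_sub_le f.continuous hC N (N + k)
  · simpa using norm_intervalIntegral_sub_le f.continuous hC 0 k

namespace IsAlgebraWithMeanValue

variable {A : NonUnitalSubalgebra ℝ (ℝ →ᵇ ℝ)}

theorem tendsto_intervalAvg (hA : IsAlgebraWithMeanValue A) {f : ℝ →ᵇ ℝ} (hf : f ∈ A) :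
    Tendsto (intervalAvg f) atTop (𝓝 (meanValue f)) := by
  obtain ⟨m, hm⟩ := hA.exists_meanValue f hf
  rw [hm.meanValue_eq]
  exact hm.tendsto_intervalAvg

theorem meanValue_eq (hA : IsAlgebraWithMeanValue A) {f : ℝ →ᵇ ℝ} (hf : f ∈ A) {m : ℝ}
    (h : Tendsto (intervalAvg f) atTop (𝓝 m)) : meanValue f = m :=
  tendsto_nhds_unique (hA.tendsto_intervalAvg hf) h

theorem meanValue_add (hA : IsAlgebraWithMeanValue A) {f g : ℝ →ᵇ ℝ} (hf : f ∈ A) (hg : g ∈ A) :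
    meanValue ⇑(f + g) = meanValue f + meanValue g :=
  hA.meanValue_eq (A.add_mem hf hg) <|
    ((hA.tendsto_intervalAvg hf).add (hA.tendsto_intervalAvg hg)).congr fun N =>
      (intervalAvg_add f.continuous g.continuous N).symm

theorem meanValue_smul (hA : IsAlgebraWithMeanValue A) {f : ℝ →ᵇ ℝ} (hf : f ∈ A) (c : ℝ) :
    meanValue ⇑(c • f) = c * meanValue f :=
  hA.meanValue_eq (A.smul_mem c hf) <|
    ((hA.tendsto_intervalAvg hf).const_mul c).congr fun N =>
      (intervalAvg_const_mul f c N).symm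

theorem meanValue_sub (hA : IsAlgebraWithMeanValue A) {f g : ℝ →ᵇ ℝ} (hf : f ∈ A) (hg : g ∈ A) :
    meanValue ⇑(f - g) = meanValue f - meanValue g := by
  have h := hA.meanValue_add (A.sub_mem hf hg) hg
  rw [sub_add_cancel] at h
  linarith

theorem meanValue_sum (hA : IsAlgebraWithMeanValue A) {ι : Type*} (s : Finset ι)
    {f : ι → ℝ →ᵇ ℝ} (hf : ∀ i, f i ∈ A) :
    meanValue ⇑(∑ i ∈ s, f i) = ∑ i ∈ s, meanValue (f i) := by
  classical
  induction s using Finset.induction_on with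
  | empty =>
    have := hA.meanValue_smul A.zero_mem 0
    rw [zero_smul, zero_mul] at this
    simpa using this
  | insert i s hi ih =>
    rw [Finset.sum_insert hi, Finset.sum_insert hi,
      hA.meanValue_add (hf i) (sum_mem fun j _ => hf j), ih]

theorem meanValue_mono (hA : IsAlgebraWithMeanValue A) {f g : ℝ →ᵇ ℝ} (hf : f ∈ A) (hg : g ∈ A)
    (h : ∀ x, f x ≤ g x) : meanValue f ≤ meanValue g :=
  le_of_tendsto_of_tendsto' (hA.tendsto_intervalAvg hf) (hA.tendsto_intervalAvg hg)
    fun N => intervalAvg_mono f.continuous g.continuous h N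

theorem meanValue_translate (hA : IsAlgebraWithMeanValue A) {f : ℝ →ᵇ ℝ} (hf : f ∈ A) (k : ℝ) :
    meanValue (translate k f) = meanValue f := by
  refine hA.meanValue_eq (hA.translate_mem f hf k) ?_
  simpa using (tendsto_intervalAvg_translate_sub f k).add (hA.tendsto_intervalAvg hf)

theorem meanValue_const (c : ℝ) : meanValue ⇑(BoundedContinuousFunction.const ℝ c) = c := by
  refine HasMeanValue.meanValue_eq fun g _ _ => ?_
  simp only [BoundedContinuousFunction.const_apply, integral_const_mul]
  exact tendsto_const_nhds

theorem meanValue_mul_self_nonneg (hA : IsAlgebraWithMeanValue A) {f : ℝ →ᵇ ℝ} (hf : f ∈ A) :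
    0 ≤ meanValue ⇑(f * f) := by
  refine ge_of_tendsto' (hA.tendsto_intervalAvg (A.mul_mem hf hf)) fun N => ?_
  refine div_nonneg (intervalIntegral.integral_nonneg (by positivity) fun x _ => ?_) (by positivity)
  exact mul_self_nonneg _

theorem meanValue_mul_self_add_le (hA : IsAlgebraWithMeanValue A) {f g : ℝ →ᵇ ℝ} (hf : f ∈ A)
    (hg : g ∈ A) : meanValue ⇑((f + g) * (f + g)) ≤
      2 * meanValue ⇑(f * f) + 2 * meanValue ⇑(g * g) := by
  have hff := A.mul_mem hf hf
  have hgg := A.mul_mem hg hg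
  have hfg := A.add_mem hf hg
  rw [← hA.meanValue_smul hff, ← hA.meanValue_smul hgg,
    ← hA.meanValue_add (A.smul_mem _ hff) (A.smul_mem _ hgg)]
  refine hA.meanValue_mono (A.mul_mem hfg hfg)
    (A.add_mem (A.smul_mem _ hff) (A.smul_mem _ hgg)) fun x => ?_
  simp only [BoundedContinuousFunction.coe_mul, BoundedContinuousFunction.coe_add,
    BoundedContinuousFunction.coe_smul, Pi.mul_apply, Pi.add_apply, smul_eq_mul]
  nlinarith [sq_nonneg (f x - g x)]

theorem meanValue_sq_le (hA : IsAlgebraWithMeanValue A)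
    (hc : ∀ c : ℝ, BoundedContinuousFunction.const ℝ c ∈ A) {f : ℝ →ᵇ ℝ} (hf : f ∈ A) :
    meanValue f ^ 2 ≤ meanValue ⇑(f * f) := by
  set m := meanValue f with hm
  have hff := A.mul_mem hf hf
  have h1 := hA.meanValue_mono (A.smul_mem (2 * m) hf) (A.add_mem hff (hc (m ^ 2))) fun x => by
    simp only [BoundedContinuousFunction.coe_mul, BoundedContinuousFunction.coe_add,
      BoundedContinuousFunction.coe_smul, Pi.mul_apply, Pi.add_apply, smul_eq_mul,
      BoundedContinuousFunction.const_apply]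
    nlinarith [sq_nonneg (f x - m)]
  rw [hA.meanValue_smul hf, hA.meanValue_add hff (hc _), meanValue_const, ← hm] at h1
  linarith

end IsAlgebraWithMeanValue

theorem besicovitchSeminorm_eq (f : ℝ →ᵇ ℝ) :
    besicovitchSeminorm f = Real.sqrt (meanValue ⇑(f * f)) := by
  unfold besicovitchSeminorm
  congr 2
  funext x
  simp [sq]

/-- A quantitative criterion for ergodicity. -/
theorem IsAlgebraWithMeanValue.isErgodicAlgebra {A : NonUnitalSubalgebra ℝ (ℝ →ᵇ ℝ)}
    (hA : IsAlgebraWithMeanValue A) (hc : ∀ c : ℝ, BoundedContinuousFunction.const ℝ c ∈ A) {C : ℝ}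
    (h : ∀ g ∈ A, ∀ δ : ℝ,
      (∀ k, meanValue ⇑((translate k g - g) * (translate k g - g)) ≤ δ) →
      meanValue ⇑((g - .const ℝ (meanValue g)) * (g - .const ℝ (meanValue g))) ≤ C * δ) :
    IsErgodicAlgebra A := by
  refine ⟨hA, fun u hu hinv => ?_⟩
  obtain ⟨huA, hcau⟩ := hu
  have hcau' : ∀ δ > 0, ∃ N : ℕ, ∀ m ≥ N, ∀ n ≥ N,
      meanValue ⇑((u m - u n) * (u m - u n)) < δ := by
    intro δ hδ
    obtain ⟨N, hN⟩ := hcau (Real.sqrt δ) (Real.sqrt_pos.2 hδ)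
    refine ⟨N, fun m hm n hn => ?_⟩
    have := hN m hm n hn
    rw [besicovitchSeminorm_eq] at this
    exact (Real.sqrt_lt_sqrt_iff (hA.meanValue_mul_self_nonneg (A.sub_mem (huA m) (huA n)))).1 this
  have hinv' : ∀ k, Tendsto (fun n => meanValue
      ⇑((translate k (u n) - u n) * (translate k (u n) - u n))) atTop (𝓝 0) := by
    intro k
    have := (hinv k).pow 2
    simp only [besicovitchSeminorm_eq] at this
    rw [zero_pow two_ne_zero] at this
    refine this.congr fun n => Real.sq_sqrt ?_
    exact hA.meanValue_mul_self_nonneg (A.sub_mem (hA.translate_mem _ (huA n) k) (huA n))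
  have hvar : Tendsto (fun n => meanValue ⇑((u n - .const ℝ (meanValue (u n))) *
      (u n - .const ℝ (meanValue (u n))))) atTop (𝓝 0) := by
    -- For fixed `m` and `k`, compare with `u n` and let `n → ∞`: the defect of `u n` vanishes, and
    -- the two differences contribute `2 * δ + 4 * δ`. The resulting bound `6 * δ` is uniform in `k`
    -- although the convergence in `n` need not be.
    have hb : ∀ δ > 0, ∃ N : ℕ, ∀ m ≥ N, meanValue ⇑((u m - .const ℝ (meanValue (u m))) *
      (u m - .const ℝ (meanValue (u m)))) ≤ C * (6 * δ) := by
      intro δ hδ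
      obtain ⟨N, hN⟩ := hcau' δ hδ
      refine ⟨N, fun m hm => h _ (huA m) _ fun k => ?_⟩
      have hlim := ((hinv' k).const_mul 4).const_add (6 * δ)
      rw [mul_zero, add_zero] at hlim
      refine ge_of_tendsto hlim ?_
      filter_upwards [eventually_ge_atTop N] with n hn
      have e : translate k (u m) - u m = translate k (u m - u n) +
          ((translate k (u n) - u n) + (u n - u m)) := by
        ext x
        simp
      have hmn := A.sub_mem (huA m) (huA n)
      have h1 := hA.translate_mem _ hmn k
      have h2 := A.sub_mem (hA.translate_mem _ (huA n) k) (huA n)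
      have h3 := A.sub_mem (huA n) (huA m)
      have h4 := hA.meanValue_mul_self_add_le h1 (A.add_mem h2 h3)
      have h5 := hA.meanValue_mul_self_add_le h2 h3
      have h6 : meanValue ⇑(translate k (u m - u n) * translate k (u m - u n)) =
          meanValue ⇑((u m - u n) * (u m - u n)) :=
        hA.meanValue_translate (A.mul_mem hmn hmn) k
      rw [e]
      linarith [hN m hm n hn, hN n hn m hm]
    refine (Metric.tendsto_atTop).2 fun ε hε => ?_
    -- `|C| + 1` is used because no sign of `C` is assumed.
    obtain ⟨N, hN⟩ := hb (ε / (12 * (|C| + 1))) (by positivity)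
    refine ⟨N, fun n hn => ?_⟩
    rw [Real.dist_eq, sub_zero, abs_of_nonneg (hA.meanValue_mul_self_nonneg
      (A.sub_mem (huA n) (hc _)))]
    refine (hN n hn).trans_lt ?_
    calc C * (6 * (ε / (12 * (|C| + 1)))) ≤ (|C| + 1) * (6 * (ε / (12 * (|C| + 1)))) := by
          gcongr
          linarith [le_abs_self C]
      _ = ε / 2 := by field_simp; norm_num
      _ < ε := by linarith
  -- The mean value is a contraction for the Besicovitch seminorm, so the means converge; their
  -- limit is the required constant.
  have hmean : CauchySeq fun n => meanValue (u n) := by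
    refine Metric.cauchySeq_iff.2 fun ε hε => ?_
    obtain ⟨N, hN⟩ := hcau' (ε ^ 2) (by positivity)
    refine ⟨N, fun m hm n hn => ?_⟩
    rw [Real.dist_eq, ← hA.meanValue_sub (huA m) (huA n)]
    exact abs_lt_of_sq_lt_sq ((hA.meanValue_sq_le hc (A.sub_mem (huA m) (huA n))).trans_lt
      (hN m hm n hn)) hε.le
  obtain ⟨c, hcl⟩ := cauchySeq_tendsto_of_complete hmean
  refine ⟨c, ?_⟩
  unfold BesicovitchEq
  simp only [besicovitchSeminorm_eq]
  rw [← Real.sqrt_zero]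
  refine (Real.continuous_sqrt.tendsto 0).comp ?_
  have hlim := (hvar.const_mul 2).add (((hcl.sub_const c).pow 2).const_mul 2)
  simp only [sub_self, ne_eq, OfNat.ofNat_ne_zero, not_false_eq_true, zero_pow, mul_zero,
    add_zero] at hlim
  refine squeeze_zero (fun n => hA.meanValue_mul_self_nonneg (A.sub_mem (huA n) (hc c)))
    (fun n => ?_) hlim
  have e : u n - .const ℝ c = (u n - .const ℝ (meanValue (u n))) +
      .const ℝ (meanValue (u n) - c) := by
    ext x
    simp
  have e2 : (BoundedContinuousFunction.const ℝ (meanValue (u n) - c)) *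
      (BoundedContinuousFunction.const ℝ (meanValue (u n) - c)) =
      BoundedContinuousFunction.const ℝ ((meanValue (u n) - c) ^ 2) := by
    ext x
    simp [sq]
  have := hA.meanValue_mul_self_add_le (A.sub_mem (huA n) (hc (meanValue (u n))))
    (hc (meanValue (u n) - c))
  rwa [e2, IsAlgebraWithMeanValue.meanValue_const, ← e] at this

/-! ### The algebra of local functions -/

/-- The bounded continuous functions whose oscillation tends to zero along a filter of pairs. -/
def oscAlgebra (F : Filter (ℝ × ℝ)) : NonUnitalSubalgebra ℝ (ℝ →ᵇ ℝ) where
  carrier := {g | Tendsto (fun p => g p.1 - g p.2) F (𝓝 0)}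
  zero_mem' := by simpa using tendsto_const_nhds
  add_mem' {f g} hf hg := by
    have := Tendsto.add hf hg
    rw [add_zero] at this
    refine this.congr fun p => ?_
    simp only [BoundedContinuousFunction.coe_add, Pi.add_apply]
    ring
  smul_mem' c f hf := by
    have := Tendsto.const_mul c hf
    rw [mul_zero] at this
    refine this.congr fun p => ?_
    simp only [BoundedContinuousFunction.coe_smul, smul_eq_mul]
    ring
  mul_mem' {f g} hf hg := by
    have h1 : Tendsto (fun p : ℝ × ℝ => f p.1 * (g p.1 - g p.2)) F (𝓝 0) :=
      isBoundedUnder_le_mul_tendsto_zero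
        (isBoundedUnder_of ⟨‖f‖, fun p => f.norm_coe_le_norm _⟩) hg
    have h2 : Tendsto (fun p : ℝ × ℝ => g p.2 * (f p.1 - f p.2)) F (𝓝 0) :=
      isBoundedUnder_le_mul_tendsto_zero
        (isBoundedUnder_of ⟨‖g‖, fun p => g.norm_coe_le_norm _⟩) hf
    have := h1.add h2
    rw [add_zero] at this
    refine this.congr fun p => ?_
    simp only [BoundedContinuousFunction.coe_mul, Pi.mul_apply]
    ring

theorem mem_oscAlgebra {F : Filter (ℝ × ℝ)} {g : ℝ →ᵇ ℝ} :
    g ∈ oscAlgebra F ↔ Tendsto (fun p => g p.1 - g p.2) F (𝓝 0) := Iff.rfl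

theorem isClosed_oscAlgebra (F : Filter (ℝ × ℝ)) : IsClosed (oscAlgebra F : Set (ℝ →ᵇ ℝ)) := by
  refine isClosed_of_closure_subset fun g hg => ?_
  rw [SetLike.mem_coe, mem_oscAlgebra, Metric.tendsto_nhds]
  intro ε hε
  obtain ⟨f, hf, hd⟩ := Metric.mem_closure_iff.1 hg (ε / 3) (by positivity)
  rw [SetLike.mem_coe, mem_oscAlgebra, Metric.tendsto_nhds] at hf
  filter_upwards [hf (ε / 3) (by positivity)] with p hp
  rw [Real.dist_eq, sub_zero] at hp ⊢
  have h : ∀ x, |g x - f x| < ε / 3 := fun x =>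
    (BoundedContinuousFunction.dist_coe_le_dist x).trans_lt hd
  have h1 := abs_lt.1 (h p.1)
  have h2 := abs_lt.1 (h p.2)
  have h3 := abs_lt.1 hp
  rw [abs_lt]
  constructor <;> linarith

/-- The pairs of points that lie in the same position relative to integers around which `x` shows
the same word of radius `R`. -/
def agreeSet (x : SeqSpace) (K : ℝ) (R : ℕ) : Set (ℝ × ℝ) :=
  {p | ∃ (n m : ℤ) (t : ℝ), |t| ≤ K ∧ window R (shiftSeq n x) = window R (shiftSeq m x) ∧
    p = (n + t, m + t)}

/-- The filter generated by the sets `agreeSet x K R`, for `R → ∞`. -/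
def agreeFilter (x : SeqSpace) (K : ℝ) : Filter (ℝ × ℝ) := ⨅ R : ℕ, 𝓟 (agreeSet x K R)

theorem hasBasis_agreeFilter (x : SeqSpace) (K : ℝ) :
    (agreeFilter x K).HasBasis (fun _ => True) (agreeSet x K) := by
  refine hasBasis_iInf_principal (directed_of_isDirected_le fun R S hRS => ?_)
  rintro p ⟨n, m, t, ht, hw, hp⟩
  exact ⟨n, m, t, ht, window_eq_of_le hRS hw, hp⟩

/-- The bounded uniformly continuous functions whose values are determined, up to arbitrarily small
errors and locally uniformly, by words of `x`. -/
def localAlgebra (x : SeqSpace) : NonUnitalSubalgebra ℝ (ℝ →ᵇ ℝ) :=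
  oscAlgebra (uniformity ℝ ⊔ ⨆ K : ℝ, agreeFilter x K)

/-- Uniform continuity and locality are both vanishing oscillation along a filter of pairs, so
taking the supremum of these filters gives the algebra and its closedness in one stroke. The range
of `t` is arbitrary so that translation by `k` only enlarges `K` to `K + |k|`. -/
theorem mem_localAlgebra {x : SeqSpace} {g : ℝ →ᵇ ℝ} :
    g ∈ localAlgebra x ↔ UniformContinuous g ∧ ∀ K : ℝ, ∀ ε > 0, ∃ R : ℕ, ∀ n m : ℤ,
      window R (shiftSeq n x) = window R (shiftSeq m x) →
        ∀ t : ℝ, |t| ≤ K → |g (n + t) - g (m + t)| ≤ ε := by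
  rw [localAlgebra, mem_oscAlgebra, tendsto_sup, tendsto_iSup]
  refine and_congr ?_ (forall_congr' fun K => ?_)
  · rw [UniformContinuous, tendsto_uniformity_iff_dist_tendsto_zero,
      tendsto_zero_iff_norm_tendsto_zero]
    rfl
  · rw [(hasBasis_agreeFilter x K).tendsto_iff Metric.nhds_basis_closedBall]
    refine forall₂_congr fun ε _ => exists_congr fun R => ?_
    constructor
    · rintro ⟨-, h⟩ n m hw t ht
      simpa using h _ ⟨n, m, t, ht, hw, rfl⟩
    · refine fun h => ⟨trivial, ?_⟩
      rintro _ ⟨n, m, t, ht, hw, rfl⟩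
      simpa using h n m hw t ht

theorem const_mem_localAlgebra (x : SeqSpace) (c : ℝ) :
    BoundedContinuousFunction.const ℝ c ∈ localAlgebra x := by
  rw [mem_localAlgebra]
  exact ⟨uniformContinuous_const, fun K ε hε => ⟨0, fun n m _ t _ => by simpa using hε.le⟩⟩

theorem translate_mem_localAlgebra {x : SeqSpace} {g : ℝ →ᵇ ℝ} (hg : g ∈ localAlgebra x) (k : ℝ) :
    translate k g ∈ localAlgebra x := by
  rw [mem_localAlgebra] at hg ⊢
  refine ⟨hg.1.comp (uniformContinuous_id.add uniformContinuous_const), fun K ε hε => ?_⟩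
  obtain ⟨R, hR⟩ := hg.2 (K + |k|) ε hε
  refine ⟨R, fun n m hw t ht => ?_⟩
  have := hR n m hw (t + k) ((abs_add_le _ _).trans (by gcongr))
  simpa only [translate_apply, add_assoc] using this

theorem isLocalSeq_integral {x : SeqSpace} {g : ℝ →ᵇ ℝ} (hg : g ∈ localAlgebra x) :
    IsLocalSeq x fun n => ∫ t in (0 : ℝ)..1, g (n + t) := by
  intro ε hε
  obtain ⟨R, hR⟩ := (mem_localAlgebra.1 hg).2 1 ε hε
  refine ⟨R, fun n m hw => ?_⟩
  have hi : ∀ n : ℤ, IntervalIntegrable (fun t => g (n + t)) volume 0 1 := fun n =>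
    (g.continuous.comp (continuous_const.add continuous_id)).intervalIntegrable _ _
  rw [← intervalIntegral.integral_sub (hi n) (hi m), ← Real.norm_eq_abs]
  refine (intervalIntegral.norm_integral_le_of_norm_le_const (C := ε) fun t ht => ?_).trans
    (by simp)
  rw [Set.uIoc_of_le zero_le_one] at ht
  exact hR n m hw t (abs_le.2 ⟨by linarith [ht.1], ht.2⟩)

theorem IsGeneric.exists_hasSeqMean_integral {q : ℝ} {x : SeqSpace} (hx : IsGeneric q x)
    {g : ℝ →ᵇ ℝ} (hg : g ∈ localAlgebra x) :
    ∃ m, HasSeqMean (fun n => ∫ t in (0 : ℝ)..1, g (n + t)) m ∧ HasMeanValue g m := by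
  obtain ⟨m, hm⟩ := hx.exists_hasSeqMean (isLocalSeq_integral hg)
  exact ⟨m, hm, hasMeanValue_of_hasSeqMean g.continuous (fun y => g.norm_coe_le_norm y) hm⟩

theorem IsGeneric.isAlgebraWithMeanValue {q : ℝ} {x : SeqSpace} (hx : IsGeneric q x) :
    IsAlgebraWithMeanValue (localAlgebra x) where
  uniformContinuous _ hf := (mem_localAlgebra.1 hf).1
  isClosed := isClosed_oscAlgebra _
  translate_mem _ hf k := translate_mem_localAlgebra hf k
  exists_meanValue _ hf := by
    obtain ⟨m, -, hm⟩ := hx.exists_hasSeqMean_integral hf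
    exact ⟨m, hm⟩

/-! ### Ergodicity of the algebra of local functions -/

/-- The average of `g` over `[s, s + L]` is replaced by finitely many translates, since linearity of
the mean value is available for finite sums. Each cell of length `1 / Q` contributes an error of at
most `ε / Q`. -/
theorem abs_riemannSum_sub_le {g : ℝ → ℝ} (hg : Continuous g) {ε : ℝ} {L Q : ℕ} (hL : 0 < L)
    (hQ : 0 < Q) (h : ∀ u v : ℝ, |u - v| ≤ 1 / Q → |g u - g v| ≤ ε) (s : ℝ) :
    |(∑ j ∈ Finset.range (L * Q), g (s + j / Q)) / (L * Q) - (∫ u in s..(s + L), g u) / L| ≤ ε := by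
  have hL' : (0 : ℝ) < L := by exact_mod_cast hL
  have hQ' : (0 : ℝ) < Q := by exact_mod_cast hQ
  have e1 : ∫ u in s..(s + L), g u =
      ∑ j ∈ Finset.range (L * Q), ∫ u in (s + j / Q)..(s + (j + 1 : ℕ) / Q), g u := by
    rw [intervalIntegral.sum_integral_adjacent_intervals (a := fun j : ℕ => s + (j : ℝ) / Q)
      fun k _ => hg.intervalIntegrable _ _]
    push_cast
    rw [mul_div_cancel_right₀ _ hQ'.ne', zero_div, add_zero]
  have e2 : ∀ j : ℕ, |g (s + j / Q) / Q - ∫ u in (s + j / Q)..(s + (j + 1 : ℕ) / Q), g u| ≤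
      ε / Q := by
    intro j
    have hlen : (s + ((j + 1 : ℕ) : ℝ) / Q) - (s + j / Q) = 1 / Q := by
      push_cast
      ring
    have e3 : g (s + j / Q) / Q - ∫ u in (s + j / Q)..(s + (j + 1 : ℕ) / Q), g u =
        ∫ u in (s + j / Q)..(s + (j + 1 : ℕ) / Q), (g (s + j / Q) - g u) := by
      rw [intervalIntegral.integral_sub (by simp) (hg.intervalIntegrable _ _),
        intervalIntegral.integral_const, hlen, smul_eq_mul]
      ring
    rw [e3, ← Real.norm_eq_abs]
    refine (intervalIntegral.norm_integral_le_of_norm_le_const (C := ε) fun u hu => ?_).trans ?_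
    · have h0 : (0 : ℝ) < 1 / Q := by positivity
      rw [Set.uIoc_of_le (by linarith)] at hu
      refine h _ _ ?_
      rw [abs_sub_comm, abs_of_nonneg (by linarith [hu.1])]
      linarith [hu.2]
    · rw [hlen, abs_of_nonneg (by positivity)]
      exact le_of_eq (by ring)
  have e4 : (∑ j ∈ Finset.range (L * Q), g (s + j / Q)) / (L * Q) - (∫ u in s..(s + L), g u) / L =
      (∑ j ∈ Finset.range (L * Q),
        (g (s + j / Q) / Q - ∫ u in (s + j / Q)..(s + (j + 1 : ℕ) / Q), g u)) / L := by
    rw [Finset.sum_sub_distrib, ← e1, ← Finset.sum_div, sub_div, div_div, mul_comm (Q : ℝ)]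
  rw [e4, abs_div, Nat.abs_cast, div_le_iff₀ hL']
  refine (Finset.abs_sum_le_sum_abs _ _).trans ((Finset.sum_le_sum fun j _ => e2 j).trans ?_)
  rw [Finset.sum_const, Finset.card_range, nsmul_eq_mul]
  push_cast
  exact le_of_eq (by field_simp)

/-- Moving the base point from `s` to `n` changes the integral only by two end pieces of length at
most `1`. -/
theorem abs_integral_div_sub_le {g : ℝ → ℝ} (hg : Continuous g) {C : ℝ} (hC : ∀ x, |g x| ≤ C)
    {n s : ℝ} (hs : |s - n| ≤ 1) (L : ℕ) :
    |(∫ u in s..(s + L), g u) / L -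
      (∑ j ∈ Finset.range L, ∫ t in (0 : ℝ)..1, g (n + j + t)) / L| ≤ (C + C) / L := by
  have hC0 : 0 ≤ C := (abs_nonneg _).trans (hC 0)
  have e1 : ∑ j ∈ Finset.range L, ∫ t in (0 : ℝ)..1, g (n + j + t) = ∫ u in n..(n + L), g u := by
    have := intervalIntegral_eq_sum (g := fun u => g (n + u)) (by fun_prop) L
    simp only [add_assoc]
    rw [← this, intervalIntegral.integral_comp_add_left (fun u => g u), add_zero]
  have hi : ∀ a b, IntervalIntegrable g volume a b := fun a b => hg.intervalIntegrable _ _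
  have e2 : ∀ s, ∫ u in s..(s + L), g u =
      (∫ u in (0 : ℝ)..(s + L), g u) - ∫ u in (0 : ℝ)..s, g u := fun s =>
    (intervalIntegral.integral_interval_sub_left (hi _ _) (hi _ _)).symm
  rw [e1, ← sub_div, abs_div, Nat.abs_cast, e2, e2, sub_sub_sub_comm]
  gcongr
  refine (abs_sub _ _).trans (add_le_add ?_ ?_)
  · refine (norm_intervalIntegral_sub_le hg hC (n + L) (s + L)).trans ?_
    rw [add_sub_add_right_eq_sub]
    exact mul_le_of_le_one_right hC0 hs
  · exact (norm_intervalIntegral_sub_le hg hC n s).trans (mul_le_of_le_one_right hC0 hs)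

theorem sq_sub_avg_le (b : ℕ → ℝ) (y : ℝ) {P : ℕ} (hP : 0 < P) :
    (y - (∑ j ∈ Finset.range P, b j) / P) ^ 2 ≤ (∑ j ∈ Finset.range P, (b j - y) ^ 2) / P := by
  have hP' : (0 : ℝ) < P := by exact_mod_cast hP
  have h := sq_sum_le_card_mul_sum_sq (s := Finset.range P) (f := fun j => b j - y)
  rw [Finset.card_range] at h
  have e : y - (∑ j ∈ Finset.range P, b j) / P = -((∑ j ∈ Finset.range P, (b j - y)) / P) := by
    rw [Finset.sum_sub_distrib, Finset.sum_const, Finset.card_range, nsmul_eq_mul]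
    field_simp
    ring
  rw [e, neg_sq, div_pow, div_le_div_iff₀ (by positivity) hP']
  exact (mul_le_mul_of_nonneg_right h hP'.le).trans_eq (by ring)

/-- By convexity, the mean-square distance from `g` to an average of its translates is at most `√δ`,
and long averages are nearly constant in mean square. The factor `2` comes from `(a + b)² ≤ 2a² +
2b²`. -/
theorem IsGeneric.meanValue_variance_le {q : ℝ} [IsProbabilityMeasure (twoPointMeasure q)]
    {x : SeqSpace} (hx : IsGeneric q x) {g : ℝ →ᵇ ℝ} (hg : g ∈ localAlgebra x) {δ : ℝ}
    (hδ : ∀ k, meanValue ⇑((translate k g - g) * (translate k g - g)) ≤ δ) :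
    meanValue ⇑((g - .const ℝ (meanValue g)) * (g - .const ℝ (meanValue g))) ≤ 2 * δ := by
  have hA := hx.isAlgebraWithMeanValue
  obtain ⟨m, hm, hgm⟩ := hx.exists_hasSeqMean_integral hg
  rw [hgm.meanValue_eq]
  refine le_of_forall_pos_le_add fun η hη => ?_
  -- The final error is `16 * ε ^ 2 + 4 * (η / 8) = η`.
  set ε := Real.sqrt (η / 32)
  have hε : 0 < ε := Real.sqrt_pos.2 (by positivity)
  have hε2 : ε ^ 2 = η / 32 := Real.sq_sqrt (by positivity)
  have hgC : ∀ y, |g y| ≤ ‖g‖ := fun y => g.norm_coe_le_norm y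
  obtain ⟨Q, hQ, hgQ⟩ : ∃ Q : ℕ, 0 < Q ∧ ∀ u v, |u - v| ≤ 1 / (Q : ℝ) → |g u - g v| ≤ ε := by
    obtain ⟨ρ, hρ, h⟩ := Metric.uniformContinuous_iff.1 (mem_localAlgebra.1 hg).1 ε hε
    obtain ⟨Q, hQ⟩ := exists_nat_one_div_lt hρ
    refine ⟨Q + 1, by omega, fun u v huv => (h ?_).le⟩
    push_cast at huv
    exact huv.trans_lt hQ
  obtain ⟨L₀, hL₀⟩ := exists_nat_gt ((‖g‖ + ‖g‖) / ε)
  -- `L ≥ L₀ + 1` makes `L` positive and keeps the boundary error `2‖g‖ / L` below `ε`.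
  obtain ⟨L, hLL₀, hL⟩ := hx.eventually_avg_sq_le (isLocalSeq_integral hg) hm
    (η := η / 8) (by positivity) (L₀ + 1)
  have hL0 : 0 < L := by omega
  have hL0' : (0 : ℝ) < L := by exact_mod_cast hL0
  have hLε : (‖g‖ + ‖g‖) / L ≤ ε := by
    rw [div_le_iff₀ hL0']
    rw [div_lt_iff₀ hε] at hL₀
    have : (L₀ : ℝ) ≤ L := by exact_mod_cast (by omega : L₀ ≤ L)
    exact hL₀.le.trans ((mul_le_mul_of_nonneg_right this hε.le).trans_eq (mul_comm _ _))
  have hP : 0 < L * Q := Nat.mul_pos hL0 hQ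
  set d : ℤ → ℝ := fun n =>
    (∑ j ∈ Finset.range L, ∫ t in (0 : ℝ)..1, g (((n + j : ℤ) : ℝ) + t)) / L with hd
  set v : ℕ → ℝ →ᵇ ℝ := fun j =>
    (translate (j / Q) g - g) * (translate (j / Q) g - g) with hv
  set w : ℝ →ᵇ ℝ := (g - .const ℝ m) * (g - .const ℝ m) with hw
  have hvA : ∀ j, v j ∈ localAlgebra x := fun j =>
    mul_mem (sub_mem (hA.translate_mem g hg _) hg) (sub_mem (hA.translate_mem g hg _) hg)
  have hwA : w ∈ localAlgebra x :=
    mul_mem (sub_mem hg (const_mem_localAlgebra x m)) (sub_mem hg (const_mem_localAlgebra x m))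
  have hsA : ∑ j ∈ Finset.range (L * Q), v j ∈ localAlgebra x := sum_mem fun j _ => hvA j
  set c : ℝ := 2 / (L * Q : ℕ)
  have hhA : w - c • ∑ j ∈ Finset.range (L * Q), v j ∈ localAlgebra x :=
    sub_mem hwA (SMulMemClass.smul_mem c hsA)
  -- With `B` the average of the translates at `n + t`, `(g - m)² ≤ 2(g - B)² + 2(B - m)²`. The
  -- first term is absorbed by `c • ∑ v j`; in the second, `B` is within `2 * ε` of the block
  -- average `d n`.
  have hpt : ∀ (n : ℕ) (t : ℝ), t ∈ Set.Icc (0 : ℝ) 1 →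
      (w - c • ∑ j ∈ Finset.range (L * Q), v j) (n + t) ≤ 16 * ε ^ 2 + 4 * (d n - m) ^ 2 := by
    intro n t ht
    set s : ℝ := n + t with hs
    set B := (∑ j ∈ Finset.range (L * Q), g (s + j / Q)) / (L * Q : ℕ) with hB
    have hBd : |B - d n| ≤ 2 * ε := by
      have h1 := abs_riemannSum_sub_le g.continuous hL0 hQ hgQ s
      have h2 := abs_integral_div_sub_le g.continuous hgC (n := n) (s := s)
        (by rw [hs, add_sub_cancel_left, abs_of_nonneg ht.1]; exact ht.2) L
      have e : d n = (∑ j ∈ Finset.range L, ∫ t in (0 : ℝ)..1, g ((n : ℝ) + j + t)) / L := by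
        simp [hd]
      rw [hB, e]
      push_cast
      exact (abs_sub_le _ _ _).trans (by linarith)
    have hgB : 2 * (g s - B) ^ 2 ≤ (c • ∑ j ∈ Finset.range (L * Q), v j) s := by
      have h1 := sq_sub_avg_le (fun j => g (s + j / Q)) (g s) hP
      have e : (c • ∑ j ∈ Finset.range (L * Q), v j) s =
          2 * ((∑ j ∈ Finset.range (L * Q), (g (s + j / Q) - g s) ^ 2) / (L * Q : ℕ)) := by
        simp [c, hv, sq]
        ring
      rw [e]
      linarith
    have hws : w s = (g s - m) ^ 2 := by simp [hw, sq]
    rw [BoundedContinuousFunction.coe_sub, Pi.sub_apply, hws]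
    have h4 : (B - d n) ^ 2 ≤ (2 * ε) ^ 2 := sq_le_sq' (abs_le.1 hBd).1 (abs_le.1 hBd).2
    nlinarith [sq_nonneg (g s - B - (B - m)), sq_nonneg ((B - d n) - (d n - m))]
  have havg : ∀ᶠ N : ℕ in atTop,
      intervalAvg ⇑(w - c • ∑ j ∈ Finset.range (L * Q), v j) N ≤ η := by
    filter_upwards [hL] with N hN
    have h1 : ∀ n : ℕ, ∫ t in (0 : ℝ)..1, (w - c • ∑ j ∈ Finset.range (L * Q), v j) (n + t) ≤
        16 * ε ^ 2 + 4 * (d n - m) ^ 2 := by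
      intro n
      refine (intervalIntegral.integral_mono_on zero_le_one
        (g := fun _ => 16 * ε ^ 2 + 4 * (d n - m) ^ 2) ?_ (by simp) (hpt n)).trans (by simp)
      exact ((w - c • ∑ j ∈ Finset.range (L * Q), v j).continuous.comp
        (continuous_const.add continuous_id)).intervalIntegrable _ _
    rw [intervalAvg, intervalIntegral_eq_sum (BoundedContinuousFunction.continuous _)]
    have hN' : (∑ n ∈ Finset.range N, (d n - m) ^ 2) / N ≤ η / 8 := hN
    calc (∑ n ∈ Finset.range N,
          ∫ t in (0 : ℝ)..1, (w - c • ∑ j ∈ Finset.range (L * Q), v j) (n + t)) / (N : ℝ)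
        ≤ (∑ n ∈ Finset.range N, (16 * ε ^ 2 + 4 * (d n - m) ^ 2)) / N := by
          gcongr with n _
          exact h1 n
      _ = N * (16 * ε ^ 2) / N + 4 * ((∑ n ∈ Finset.range N, (d n - m) ^ 2) / N) := by
          rw [Finset.sum_add_distrib, add_div, ← Finset.mul_sum _ _ (4 : ℝ), mul_div_assoc 4]
          simp
      _ ≤ 16 * ε ^ 2 + 4 * (η / 8) := by
          refine add_le_add ?_ (by linarith)
          exact div_le_of_le_mul₀ (by positivity) (by positivity) (le_of_eq (mul_comm _ _))
      _ = η := by rw [hε2]; ring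
  have hle := le_of_tendsto (hA.tendsto_intervalAvg hhA) havg
  rw [hA.meanValue_sub hwA (SMulMemClass.smul_mem c hsA), hA.meanValue_smul hsA,
    hA.meanValue_sum _ hvA] at hle
  have hsum : ∑ j ∈ Finset.range (L * Q), meanValue (v j) ≤ (L * Q : ℕ) * δ := by
    refine (Finset.sum_le_card_nsmul _ _ δ fun j _ => hδ _).trans ?_
    simp
  have hc : c * ∑ j ∈ Finset.range (L * Q), meanValue (v j) ≤ 2 * δ := by
    refine (mul_le_mul_of_nonneg_left hsum (by positivity)).trans (le_of_eq ?_)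
    have : ((L * Q : ℕ) : ℝ) ≠ 0 := by exact_mod_cast hP.ne'
    simp only [c]
    field_simp
  linarith

theorem IsGeneric.isErgodicAlgebra {q : ℝ} [IsProbabilityMeasure (twoPointMeasure q)]
    {x : SeqSpace} (hx : IsGeneric q x) : IsErgodicAlgebra (localAlgebra x) :=
  hx.isAlgebraWithMeanValue.isErgodicAlgebra (const_mem_localAlgebra x)
    fun _ hg _ hδ => hx.meanValue_variance_le hg hδ

/-! ### The functions of the probability space -/

theorem IsProfile.uniformContinuous {φ : ℝ → ℝ} (hφ : IsProfile φ) : UniformContinuous φ :=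
  HasCompactSupport.uniformContinuous_of_continuous (h2 := hφ.continuous) <|
    HasCompactSupport.intro (isCompact_Icc (a := -(1 / 2 : ℝ)) (b := 1 / 2)) fun y hy => by
      refine hφ.eq_zero (le_of_not_gt fun h => hy ?_)
      exact ⟨(abs_lt.1 h).1.le, (abs_lt.1 h).2.le⟩

theorem IsProfile.abs_lam_le {φ : ℝ → ℝ} (hφ : IsProfile φ) (x : SeqSpace) (s : ℝ) :
    |Lam φ x s| ≤ 1 := by
  rw [hφ.lam_eq, abs_mul, abs_twoPoint, one_mul, abs_of_nonneg (hφ.nonneg _)]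
  exact hφ.le_one _

/-- Only the bumps centred at `round s` and `round t` matter. If they differ, each vanishes at the
other point, so no comparison of letters is needed and a modulus of continuity of `φ` serves for
`Λ_x`. -/
theorem IsProfile.abs_lam_sub_le {φ : ℝ → ℝ} (hφ : IsProfile φ) (x : SeqSpace) (s t : ℝ) :
    |Lam φ x s - Lam φ x t| ≤
      |φ (s - round s) - φ (t - round s)| + |φ (s - round t) - φ (t - round t)| := by
  rw [hφ.lam_eq, hφ.lam_eq]
  by_cases h : round s = round t
  · rw [h, ← mul_sub, abs_mul, abs_twoPoint, one_mul]
    exact le_add_of_nonneg_right (abs_nonneg _)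
  · have key : ∀ (u : ℝ) (n : ℤ), round u ≠ n → φ (u - n) = 0 := fun u n hn => by
      refine hφ.eq_zero ?_
      have h1 := abs_sub_round u
      have h2 : (1 : ℝ) ≤ |(round u : ℝ) - n| := by
        exact_mod_cast Int.one_le_abs (sub_ne_zero.2 hn)
      have h3 := abs_sub_le (round u : ℝ) u n
      rw [abs_sub_comm (round u : ℝ) u] at h3
      linarith
    rw [key s _ h, key t _ (Ne.symm h), sub_zero, zero_sub, abs_neg]
    refine (abs_sub _ _).trans (le_of_eq ?_)
    rw [abs_mul, abs_mul, abs_twoPoint, abs_twoPoint, one_mul, one_mul]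

theorem IsProfile.uniformContinuous_lam {φ : ℝ → ℝ} (hφ : IsProfile φ) (x : SeqSpace) :
    UniformContinuous (Lam φ x) := by
  refine Metric.uniformContinuous_iff.2 fun ε hε => ?_
  obtain ⟨ρ, hρ, h⟩ := Metric.uniformContinuous_iff.1 hφ.uniformContinuous (ε / 2) (by positivity)
  refine ⟨ρ, hρ, fun s t hst => ?_⟩
  have h1 : ∀ c : ℝ, |φ (s - c) - φ (t - c)| < ε / 2 := fun c =>
    h (by rwa [dist_sub_right])
  rw [Real.dist_eq]
  exact (hφ.abs_lam_sub_le x s t).trans_lt (by linarith [h1 (round s), h1 (round t)])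

/-- At `n + t` the function depends on `x` only through the letter at position `n + round (t + θ)`,
so equal windows give equal values, with no error. -/
theorem IsProfile.exists_mem_localAlgebra {φ : ℝ → ℝ} (hφ : IsProfile φ) (x : SeqSpace) (θ : ℝ) :
    ∃ g ∈ localAlgebra x, ∀ t, g t = Lam φ x (t + θ) := by
  have hu : UniformContinuous fun t => Lam φ x (t + θ) :=
    (hφ.uniformContinuous_lam x).comp (uniformContinuous_id.add uniformContinuous_const)
  refine ⟨.ofNormedAddCommGroup _ hu.continuous 1 fun t => hφ.abs_lam_le x _,
    mem_localAlgebra.2 ⟨hu, fun K ε hε => ?_⟩, fun t => rfl⟩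
  -- Large enough to contain `round (t + θ)`, since rounding moves a point by at most `1 / 2`.
  obtain ⟨R, hR⟩ := exists_nat_ge (K + |θ| + 1)
  refine ⟨R, fun n m hw t ht => ?_⟩
  have e : ∀ n : ℤ, Lam φ x (n + t + θ) =
      (shiftSeq n x (round (t + θ)) : ℝ) * φ (t + θ - round (t + θ)) := fun n => by
    rw [hφ.lam_eq, add_assoc, round_intCast_add]
    push_cast
    rw [add_sub_add_left_eq_sub]
    rfl
  have hr : |round (t + θ)| ≤ R := by
    have h1 := abs_sub_round (t + θ)
    have h2 := abs_add_le t θ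
    have h3 : |(round (t + θ) : ℝ)| ≤ |t + θ| + |t + θ - round (t + θ)| := by
      have := abs_sub (t + θ) (t + θ - round (t + θ))
      rwa [sub_sub_cancel] at this
    have h4 : |(round (t + θ) : ℝ)| ≤ R := by linarith
    exact_mod_cast h4
  change |Lam φ x (n + t + θ) - Lam φ x (m + t + θ)| ≤ ε
  rw [e, e, window_eq_iff.1 hw _ hr, sub_self, abs_zero]
  exact hε.le

/-- It lets almost-everywhere statements pass through the coordinates without measurability of the
set of ergodic functions. -/
theorem IsProfile.measurableEmbedding_ofCoord {φ : ℝ → ℝ} (hφ : IsProfile φ) :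
    MeasurableEmbedding (ofCoord φ) where
  injective := hφ.ofCoord_injective
  measurable := fun _ hs => hs
  measurableSet_image' s hs := by
    change MeasurableSet (ofCoord φ ⁻¹' (ofCoord φ '' s))
    rwa [Set.preimage_image_eq _ hφ.ofCoord_injective]

instance isFiniteMeasure_lebesgueIco : IsFiniteMeasure lebesgueIco := by
  constructor
  rw [lebesgueIco, (MeasurableEmbedding.subtype_coe measurableSet_Ico).comap_apply,
    Set.image_univ, Subtype.range_coe, Real.volume_Ico]
  exact ENNReal.ofReal_lt_top

end ErgodicFunctions

end

theorem mainTheorem5 (φ : ℝ → ℝ) (hφ : ErgodicFunctions.IsProfile φ)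
    (q : ℝ) (hq0 : 0 < q) (hq1 : q < 1) :
    (∀ (w : ErgodicFunctions.Omega φ) (z : ℝ),
      ErgodicFunctions.evalZero φ (ErgodicFunctions.shift φ z w) = w.1 z) ∧
    ∀ᵐ w ∂(ErgodicFunctions.omegaMeasure φ q),
      ErgodicFunctions.IsErgodicFunction
        (fun z => ErgodicFunctions.evalZero φ (ErgodicFunctions.shift φ z w)) := by
  have key : ∀ (w : ErgodicFunctions.Omega φ) (z : ℝ),
      ErgodicFunctions.evalZero φ (ErgodicFunctions.shift φ z w) = w.1 z := fun w z =>
    congrArg w.1 (zero_add z)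
  refine ⟨key, ?_⟩
  have := ErgodicFunctions.isProbabilityMeasure_twoPointMeasure hq0 hq1
  simp only [key]
  rw [ErgodicFunctions.omegaMeasure, hφ.measurableEmbedding_ofCoord.ae_map_iff]
  -- Genericity concerns only the sequence; every phase in `[0, 1)` is allowed, since the algebra
  -- contains all translates.
  filter_upwards [Measure.quasiMeasurePreserving_fst.ae (ErgodicFunctions.ae_isGeneric q)] with p hp
  obtain ⟨g, hg, hgp⟩ := hφ.exists_mem_localAlgebra p.1 p.2
  exact ⟨_, hp.isErgodicAlgebra, g, hg, hgp⟩
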